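/- Setting. Let $(\Omega,\mathcal B,\mu)$ be a $\sigma$-finite measure space with $\mu(\Omega)=\infty$, let $T:\Omega\to\Omega$ be a conservative, invertible (bijective with measurable inverse), measure-preserving, ergodic transformation, and let $f:\Omega\to\mathbb R$ be bounded and measurable (a sampling function). For $E\in\mathbb C$ and $\omega\in\Omega$ put $$A(E,\omega)=\begin{pmatrix}E-f(\omega)&-1\\1&0\end{pmatrix},$$ and let $A(E,n,\omega)=A(E,T^{n-1}\omega)\cdots A(E,\omega)$ for $n>0$, $A(E,0,\omega)=I$, and $A(E,n,\omega)=A(E,T^{-|n|}\omega)^{-1}\cdots A(E,T^{-1}\omega)^{-1}$ for $n<0$. The upper and lower Lyapunov exponents $\overline L^{\pm}(E)$, $\underline L^{\pm}(E)$ are the real numbers such that, for $\mu$-almost every $\omega$, $$\limsup_{n\to\pm\infty}\frac1{|n|}\log\|A(E,n,\omega)\|=\overline L^{\pm}(E),\qquad \liminf_{n\to\pm\infty}\frac1{|n|}\log\|A(E,n,\omega)\|=\underline L^{\pm}(E).$$ Proposition. (a) There exist $(\Omega,\mathcal B,\mu,T)$ and $f$ as above and $M>0$ such that the upper Lyapunov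 exponents exist for all $E\in\mathbb C$ and, for real $E$, $$\overline L^+(E)>\overline L^-(E)\ \text{ when } E>M,\qquad \overline L^+(E)<\overline L^-(E)\ \text{ when } E<-M.$$ (b) There exist $(\Omega,\mathcal B,\mu,T)$ and $f$ as above and $M>0$ such that the lower Lyapunov exponents exist for all $E\in\mathbb C$ and, for real $E$, $$\underline L^+(E)>\underline L^-(E)\ \text{ when } E>M,\qquad \underline L^+(E)<\underline L^-(E)\ \text{ when } E<-M.$$ -/

import Mathlib

open MeasureTheory Filter

noncomputable section

/-- The one-step transfer matrix of the discrete Schrödinger equation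
`u (n-1) + u (n+1) + f (T^n ω) u n = E u n`. -/
def stepMatrix {Ω : Type*} (f : Ω → ℝ) (E : ℂ) (ω : Ω) : Matrix (Fin 2) (Fin 2) ℂ :=
  !![E - (f ω : ℂ), -1; 1, 0]

/-- `A(E, T^(n-1) ω) ⋯ A(E, ω)`. -/
def forwardMatrix {Ω : Type*} [MeasurableSpace Ω] (T : Ω ≃ᵐ Ω) (f : Ω → ℝ) (E : ℂ) :
    ℕ → Ω → Matrix (Fin 2) (Fin 2) ℂ
  | 0, _ => 1
  | n + 1, ω => stepMatrix f E (T^[n] ω) * forwardMatrix T f E n ω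

/-- `A(E, T^(-n) ω)⁻¹ ⋯ A(E, T^(-1) ω)⁻¹`. -/
def backwardMatrix {Ω : Type*} [MeasurableSpace Ω] (T : Ω ≃ᵐ Ω) (f : Ω → ℝ) (E : ℂ) :
    ℕ → Ω → Matrix (Fin 2) (Fin 2) ℂ
  | 0, _ => 1
  | n + 1, ω => (stepMatrix f E (T.symm^[n + 1] ω))⁻¹ * backwardMatrix T f E n ω

/-- The `n`-step transfer matrix `A(E, n, ω)` for an integer `n`. -/
def transferMatrix {Ω : Type*} [MeasurableSpace Ω] (T : Ω ≃ᵐ Ω) (f : Ω → ℝ) (E : ℂ) :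
    ℤ → Ω → Matrix (Fin 2) (Fin 2) ℂ
  | Int.ofNat n, ω => forwardMatrix T f E n ω
  | Int.negSucc n, ω => backwardMatrix T f E (n + 1) ω

open scoped Matrix.Norms.L2Operator in
/-- `|n|⁻¹ log ‖A(E, n, ω)‖`, with the operator norm for the Euclidean norm on `ℂ²`. -/
def growthRate {Ω : Type*} [MeasurableSpace Ω] (T : Ω ≃ᵐ Ω) (f : Ω → ℝ) (E : ℂ)
    (n : ℤ) (ω : Ω) : ℝ :=
  1 / |(n : ℝ)| * Real.log ‖transferMatrix T f E n ω‖

/-- `L` is the upper Lyapunov exponent at energy `E`, at `+∞` for `l = atTop` and at `-∞` for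
`l = atBot`. For bounded `f` the growth rates are bounded in `n`, so the real `limsup` is the
genuine one. -/
def IsUpperLyapunov {Ω : Type*} [MeasurableSpace Ω] (μ : Measure Ω) (T : Ω ≃ᵐ Ω) (f : Ω → ℝ)
    (l : Filter ℤ) (E : ℂ) (L : ℝ) : Prop :=
  ∀ᵐ ω ∂μ, limsup (fun n : ℤ => growthRate T f E n ω) l = L

/-- `L` is the lower Lyapunov exponent at energy `E`, at `+∞` for `l = atTop` and at `-∞` for
`l = atBot`. -/
def IsLowerLyapunov {Ω : Type*} [MeasurableSpace Ω] (μ : Measure Ω) (T : Ω ≃ᵐ Ω) (f : Ω → ℝ)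
    (l : Filter ℤ) (E : ℂ) (L : ℝ) : Prop :=
  ∀ᵐ ω ∂μ, liminf (fun n : ℤ => growthRate T f E n ω) l = L

/-- `T` is a conservative, ergodic, measure preserving transformation (invertible with measurable
inverse, as a `MeasurableEquiv`) of a σ-finite space of infinite measure. -/
structure IsInfiniteErgodicSystem {Ω : Type*} [MeasurableSpace Ω] (μ : Measure Ω)
    (T : Ω ≃ᵐ Ω) : Prop where
  sigmaFinite : SigmaFinite μ
  infinite : μ Set.univ = ⊤
  ergodic : Ergodic T μ
  conservative : Conservative T μ

/-- A bounded measurable real-valued function. -/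
structure IsSamplingFunction {Ω : Type*} [MeasurableSpace Ω] (f : Ω → ℝ) : Prop where
  measurable : Measurable f
  bounded : ∃ C : ℝ, ∀ ω, |f ω| ≤ C

end

open scoped Matrix.Norms.L2Operator Topology

/-! One system serves both parts. Over the 2-adic odometer, a column of height `2 * h x` stands
above each `x`, and `f` is `-1` on its lower half and `1` on its upper half. On the tower `f = g - g
∘ T`, where `g` (`tent`) is nonnegative and unbounded. Birkhoff sums telescope: the forward sums `g
ω - g (T^n ω)` never exceed `g ω`, the backward sums `g (T^(-n) ω) - g ω` never drop below `-g ω`.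
The heights explode near `0`, so each orbit, in either time direction, again and again meets a
column that dwarfs all the time spent before (`exists_columnHalf_ge`). In the middle of such a
column the forward sum is at most `-n/2` and the backward sum at least `n/2`.

For `e = |E| > 18` the transfer products are hyperbolic: `log ‖A(E, n, ω)‖` differs from the sum of
the `log |E - f|` by at most `n δ + O(1)`, with `δ = (e/2)⁻²`. If `E > 18`, that sum is `n a - b Σ
f`, where `a` is the mean and `b` half the difference of `log (e + 1)` and `log (e - 1)`. Forward,
this gives `liminf ≥ a - δ` and `limsup ≥ a - δ + b/2`; backward, `limsup ≤ a + δ` and `liminf ≤ a +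
δ - b/2`. Since `b` has order `1/e` and `δ` order `1/e²`, `b > 4δ` (`log_gap`), and both
inequalities are strict (`productRate_lt`). For `E < -18` the function `-f` takes the place of `f`,
which exchanges the two directions.

The exponents exist for every complex `E` because the upper and lower growth rates are measurable
and `T`-invariant, hence constant almost everywhere by ergodicity. -/

/-- The product of the one-step transfer matrices with diagonal entries `z 0, …, z (n - 1)`. -/
def transferProduct (z : ℕ → ℂ) : ℕ → Matrix (Fin 2) (Fin 2) ℂ
  | 0 => 1
  | n + 1 => !![z n, -1; 1, 0] * transferProduct z n

/-- `n⁻¹ log ‖P n‖` for the transfer product `P n`. -/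
noncomputable def productRate (z : ℕ → ℂ) (n : ℕ) : ℝ :=
  1 / (n : ℝ) * Real.log ‖transferProduct z n‖

theorem transferProduct_succ' (z : ℕ → ℂ) (n : ℕ) :
    transferProduct z (n + 1) = transferProduct (fun k => z (k + 1)) n * !![z 0, -1; 1, 0] := by
  induction n with
  | zero => simp [transferProduct]
  | succ n ih => rw [transferProduct, ih, transferProduct, Matrix.mul_assoc]

/-! ### Reduction of both time directions to one-sided products. -/

section Dynamics

variable {Ω : Type*} [MeasurableSpace Ω] (T : Ω ≃ᵐ Ω) (f : Ω → ℝ) (E : ℂ)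

theorem forwardMatrix_eq_transferProduct (n : ℕ) (ω : Ω) :
    forwardMatrix T f E n ω = transferProduct (fun k => E - (f (T^[k] ω) : ℂ)) n := by
  induction n with
  | zero => rfl
  | succ n ih => rw [forwardMatrix, ih, transferProduct, stepMatrix]

theorem transfer_inv (z : ℂ) :
    (!![z, -1; 1, 0] : Matrix (Fin 2) (Fin 2) ℂ)⁻¹ = !![0, 1; -1, z] := by
  apply Matrix.inv_eq_right_inv
  ext i j
  fin_cases i <;> fin_cases j <;> simp [Matrix.mul_apply, Fin.sum_univ_two]

/-- The coordinate swap. -/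
def swapMatrix : Matrix (Fin 2) (Fin 2) ℂ := !![0, 1; 1, 0]

theorem swapMatrix_mul_self : swapMatrix * swapMatrix = 1 := by
  ext i j
  fin_cases i <;> fin_cases j <;> simp [swapMatrix, Matrix.mul_apply, Fin.sum_univ_two]

theorem swapMatrix_mem_unitary : swapMatrix ∈ unitary (Matrix (Fin 2) (Fin 2) ℂ) := by
  have h : star swapMatrix = swapMatrix := by
    ext i j
    fin_cases i <;> fin_cases j <;> simp [swapMatrix, Matrix.star_apply]
  rw [Unitary.mem_iff, h]
  exact ⟨swapMatrix_mul_self, swapMatrix_mul_self⟩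

/-- The three-term recurrence is symmetric under reversal of the index, which exchanges the two
coordinates. As the swap is unitary and an involution, a backward product has the norm of an
ordinary product along `T⁻¹ ω, T⁻² ω, …`. -/
theorem transfer_inv_eq_swap (z : ℂ) :
    (!![0, 1; -1, z] : Matrix (Fin 2) (Fin 2) ℂ) =
      swapMatrix * !![z, -1; 1, 0] * swapMatrix := by
  ext i j
  fin_cases i <;> fin_cases j <;> simp [swapMatrix, Matrix.mul_apply, Fin.sum_univ_two]

theorem backwardMatrix_eq_transferProduct (n : ℕ) (ω : Ω) :
    backwardMatrix T f E n ω =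
      swapMatrix * transferProduct (fun k => E - (f (T.symm^[k + 1] ω) : ℂ)) n * swapMatrix := by
  induction n with
  | zero => simp [backwardMatrix, transferProduct, swapMatrix_mul_self]
  | succ n ih =>
    rw [backwardMatrix, ih, stepMatrix, transfer_inv, transfer_inv_eq_swap, transferProduct]
    simp only [Matrix.mul_assoc]
    rw [← Matrix.mul_assoc swapMatrix swapMatrix, swapMatrix_mul_self, Matrix.one_mul]

theorem norm_swap_conj (A : Matrix (Fin 2) (Fin 2) ℂ) :
    ‖swapMatrix * A * swapMatrix‖ = ‖A‖ := by
  rw [CStarRing.norm_mul_mem_unitary _ swapMatrix_mem_unitary,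
    CStarRing.norm_mem_unitary_mul _ swapMatrix_mem_unitary]

theorem growthRate_natCast (n : ℕ) (ω : Ω) :
    growthRate T f E (n : ℤ) ω = productRate (fun k => E - (f (T^[k] ω) : ℂ)) n := by
  rw [growthRate, productRate, ← forwardMatrix_eq_transferProduct T]
  simp [transferMatrix]

theorem growthRate_neg_natCast (n : ℕ) (ω : Ω) :
    growthRate T f E (-(n : ℤ)) ω = productRate (fun k => E - (f (T.symm^[k + 1] ω) : ℂ)) n := by
  have h : transferMatrix T f E (-(n : ℤ)) ω = backwardMatrix T f E n ω := by
    cases n with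
    | zero => rfl
    | succ n => rfl
  rw [growthRate, productRate, h, backwardMatrix_eq_transferProduct, norm_swap_conj]
  simp

theorem map_neg_natCast_atTop : map (fun n : ℕ => -(n : ℤ)) atTop = atBot := by
  have : (fun n : ℕ => -(n : ℤ)) = (fun k : ℤ => -k) ∘ ((↑) : ℕ → ℤ) := rfl
  rw [this, ← map_map, Nat.map_cast_int_atTop]
  exact (OrderIso.neg ℤ).map_atTop

theorem limsup_growthRate_atTop (ω : Ω) :
    limsup (fun n : ℤ => growthRate T f E n ω) atTop =
      limsup (productRate (fun k => E - (f (T^[k] ω) : ℂ))) atTop := by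
  rw [← Nat.map_cast_int_atTop, limsup, map_map, ← limsup]
  exact congrArg₂ _ (funext fun n => growthRate_natCast T f E n ω) rfl

theorem liminf_growthRate_atTop (ω : Ω) :
    liminf (fun n : ℤ => growthRate T f E n ω) atTop =
      liminf (productRate (fun k => E - (f (T^[k] ω) : ℂ))) atTop := by
  rw [← Nat.map_cast_int_atTop, liminf, map_map, ← liminf]
  exact congrArg₂ _ (funext fun n => growthRate_natCast T f E n ω) rfl

theorem limsup_growthRate_atBot (ω : Ω) :
    limsup (fun n : ℤ => growthRate T f E n ω) atBot =
      limsup (productRate (fun k => E - (f (T.symm^[k + 1] ω) : ℂ))) atTop := by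
  rw [← map_neg_natCast_atTop, limsup, map_map, ← limsup]
  exact congrArg₂ _ (funext fun n => growthRate_neg_natCast T f E n ω) rfl

theorem liminf_growthRate_atBot (ω : Ω) :
    liminf (fun n : ℤ => growthRate T f E n ω) atBot =
      liminf (productRate (fun k => E - (f (T.symm^[k + 1] ω) : ℂ))) atTop := by
  rw [← map_neg_natCast_atTop, liminf, map_map, ← liminf]
  exact congrArg₂ _ (funext fun n => growthRate_neg_natCast T f E n ω) rfl

end Dynamics

/-! ### A priori bounds and shift invariance of growth rates. -/

section Bounds

theorem exists_norm_transfer_le (C : ℝ) :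
    ∃ K : ℝ, 1 ≤ K ∧ ∀ z : ℂ, ‖z‖ ≤ C →
      ‖(!![z, -1; 1, 0] : Matrix (Fin 2) (Fin 2) ℂ)‖ ≤ K ∧
      ‖(!![0, 1; -1, z] : Matrix (Fin 2) (Fin 2) ℂ)‖ ≤ K := by
  let e : Matrix (Fin 2) (Fin 2) ℂ := !![1, 0; 0, 0]
  let r : Matrix (Fin 2) (Fin 2) ℂ := !![0, -1; 1, 0]
  refine ⟨max 1 (C * ‖e‖ + ‖r‖), le_max_left _ _, fun z hz => ?_⟩
  have h : ‖(!![z, -1; 1, 0] : Matrix (Fin 2) (Fin 2) ℂ)‖ ≤ max 1 (C * ‖e‖ + ‖r‖) := by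
    have hz' : (!![z, -1; 1, 0] : Matrix (Fin 2) (Fin 2) ℂ) = z • e + r := by
      ext i j
      fin_cases i <;> fin_cases j <;> simp [e, r]
    rw [hz']
    refine le_trans (norm_add_le _ _) (le_trans ?_ (le_max_right _ _))
    rw [norm_smul]
    gcongr
  refine ⟨h, ?_⟩
  rwa [transfer_inv_eq_swap, norm_swap_conj]

theorem transferProduct_ne_zero (z : ℕ → ℂ) (n : ℕ) : transferProduct z n ≠ 0 := by
  have h : (transferProduct z n).det = 1 := by
    induction n with
    | zero => simp [transferProduct]
    | succ n ih => rw [transferProduct, Matrix.det_mul, ih, Matrix.det_fin_two]; simp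
  intro h0
  rw [h0] at h
  simp at h

theorem abs_log_sub_log_le {x y K : ℝ} (hx : 0 < x) (hy : 0 < y) (hK : 0 < K)
    (hxy : x ≤ K * y) (hyx : y ≤ K * x) : |Real.log x - Real.log y| ≤ Real.log K := by
  have h1 := Real.log_le_log hx hxy
  have h2 := Real.log_le_log hy hyx
  rw [Real.log_mul hK.ne' hy.ne'] at h1
  rw [Real.log_mul hK.ne' hx.ne'] at h2
  rw [abs_le]
  constructor <;> linarith

theorem transfer_inv_mul (z : ℂ) :
    (!![0, 1; -1, z] * !![z, -1; 1, 0] : Matrix (Fin 2) (Fin 2) ℂ) = 1 := by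
  ext i j
  fin_cases i <;> fin_cases j <;> simp [Matrix.mul_apply, Fin.sum_univ_two]

theorem transfer_mul_inv (z : ℂ) :
    (!![z, -1; 1, 0] * !![0, 1; -1, z] : Matrix (Fin 2) (Fin 2) ℂ) = 1 :=
  mul_eq_one_comm.mp (transfer_inv_mul z)

variable {z : ℕ → ℂ} {K : ℝ}

theorem abs_log_transferProduct_succ_sub (hK : 1 ≤ K)
    (h : ∀ k, ‖(!![z k, -1; 1, 0] : Matrix (Fin 2) (Fin 2) ℂ)‖ ≤ K ∧
      ‖(!![0, 1; -1, z k] : Matrix (Fin 2) (Fin 2) ℂ)‖ ≤ K) (n : ℕ) :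
    |Real.log ‖transferProduct z (n + 1)‖ - Real.log ‖transferProduct z n‖| ≤ Real.log K := by
  refine abs_log_sub_log_le (norm_pos_iff.2 (transferProduct_ne_zero _ _))
    (norm_pos_iff.2 (transferProduct_ne_zero _ _)) (by linarith) ?_ ?_
  · rw [transferProduct]
    exact (norm_mul_le _ _).trans (by gcongr; exact (h n).1)
  · calc ‖transferProduct z n‖ = ‖!![0, 1; -1, z n] * transferProduct z (n + 1)‖ := by
          rw [transferProduct, ← Matrix.mul_assoc, transfer_inv_mul, Matrix.one_mul]
      _ ≤ K * ‖transferProduct z (n + 1)‖ :=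
          (norm_mul_le _ _).trans (by gcongr; exact (h n).2)

theorem abs_log_transferProduct_succ_sub_shift (hK : 1 ≤ K)
    (h : ∀ k, ‖(!![z k, -1; 1, 0] : Matrix (Fin 2) (Fin 2) ℂ)‖ ≤ K ∧
      ‖(!![0, 1; -1, z k] : Matrix (Fin 2) (Fin 2) ℂ)‖ ≤ K) (n : ℕ) :
    |Real.log ‖transferProduct z (n + 1)‖ -
      Real.log ‖transferProduct (fun k => z (k + 1)) n‖| ≤ Real.log K := by
  refine abs_log_sub_log_le (norm_pos_iff.2 (transferProduct_ne_zero _ _))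
    (norm_pos_iff.2 (transferProduct_ne_zero _ _)) (by linarith) ?_ ?_
  · rw [transferProduct_succ', mul_comm K]
    exact (norm_mul_le _ _).trans (by gcongr; exact (h 0).1)
  · calc ‖transferProduct (fun k => z (k + 1)) n‖
        = ‖transferProduct z (n + 1) * !![0, 1; -1, z 0]‖ := by
          rw [transferProduct_succ', Matrix.mul_assoc, transfer_mul_inv, Matrix.mul_one]
      _ ≤ ‖transferProduct z (n + 1)‖ * K :=
          (norm_mul_le _ _).trans (by gcongr; exact (h 0).2)
      _ = _ := mul_comm _ _

theorem abs_log_transferProduct_le (hK : 1 ≤ K)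
    (h : ∀ k, ‖(!![z k, -1; 1, 0] : Matrix (Fin 2) (Fin 2) ℂ)‖ ≤ K ∧
      ‖(!![0, 1; -1, z k] : Matrix (Fin 2) (Fin 2) ℂ)‖ ≤ K) (n : ℕ) :
    |Real.log ‖transferProduct z n‖| ≤ n * Real.log K := by
  induction n with
  | zero => simp [transferProduct]
  | succ n ih =>
    have h1 := abs_log_transferProduct_succ_sub hK h n
    rw [abs_le] at *
    push_cast
    constructor <;> linarith

theorem abs_productRate_le (hK : 1 ≤ K)
    (h : ∀ k, ‖(!![z k, -1; 1, 0] : Matrix (Fin 2) (Fin 2) ℂ)‖ ≤ K ∧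
      ‖(!![0, 1; -1, z k] : Matrix (Fin 2) (Fin 2) ℂ)‖ ≤ K) (n : ℕ) :
    |productRate z n| ≤ Real.log K := by
  have hl : 0 ≤ Real.log K := Real.log_nonneg hK
  rcases Nat.eq_zero_or_pos n with rfl | hn
  · simpa [productRate] using hl
  · have hn' : (0 : ℝ) < n := by exact_mod_cast hn
    rw [productRate, abs_mul, abs_of_pos (by positivity : 0 < 1 / (n : ℝ)), one_div,
      inv_mul_le_iff₀ hn']
    exact abs_log_transferProduct_le hK h n

theorem productRate_isBounded {C : ℝ} (h : ∀ k, ‖z k‖ ≤ C) :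
    ∃ B : ℝ, ∀ n, |productRate z n| ≤ B := by
  obtain ⟨K, hK, hK'⟩ := exists_norm_transfer_le C
  exact ⟨_, abs_productRate_le hK fun k => hK' _ (h k)⟩

theorem tendsto_productRate_sub_shift {C : ℝ} (h : ∀ k, ‖z k‖ ≤ C) :
    Tendsto (fun n => productRate z n - productRate (fun k => z (k + 1)) n) atTop (𝓝 0) := by
  obtain ⟨K, hK, hK'⟩ := exists_norm_transfer_le C
  have hb := fun k => hK' _ (h k)
  have hlim : Tendsto (fun n : ℕ => (2 * Real.log K) / (n : ℝ)) atTop (𝓝 0) :=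
    tendsto_const_div_atTop_nhds_zero_nat _
  refine squeeze_zero_norm (fun n => ?_) hlim
  rw [productRate, productRate, ← mul_sub, norm_mul, Real.norm_eq_abs, Real.norm_eq_abs,
    abs_of_nonneg (by positivity : 0 ≤ 1 / (n : ℝ)), one_div, mul_comm, ← div_eq_mul_inv]
  gcongr
  have h1 := abs_log_transferProduct_succ_sub hK hb n
  have h2 := abs_log_transferProduct_succ_sub_shift hK hb n
  rw [abs_le] at *
  constructor <;> linarith

theorem limsup_le_limsup_of_tendsto_sub {u v : ℕ → ℝ} {B : ℝ} (hu : ∀ n, |u n| ≤ B)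
    (hv : ∀ n, |v n| ≤ B) (h : Tendsto (fun n => u n - v n) atTop (𝓝 0)) :
    limsup u atTop ≤ limsup v atTop := by
  have bu : IsBoundedUnder (· ≤ ·) atTop v := isBoundedUnder_of ⟨B, fun n => (abs_le.1 (hv n)).2⟩
  have bl : IsBoundedUnder (· ≥ ·) atTop v := isBoundedUnder_of ⟨-B, fun n => (abs_le.1 (hv n)).1⟩
  have ul : IsBoundedUnder (· ≥ ·) atTop u := isBoundedUnder_of ⟨-B, fun n => (abs_le.1 (hu n)).1⟩
  refine le_of_forall_pos_le_add fun ε hε => ?_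
  have hvε : ∀ᶠ n in atTop, v n < limsup v atTop + ε / 2 :=
    eventually_lt_of_limsup_lt (by linarith) bu
  refine limsup_le_of_le ul.isCoboundedUnder_le ?_
  filter_upwards [hvε, h.eventually (gt_mem_nhds (half_pos hε))] with n h1 h2
  linarith

theorem liminf_le_liminf_of_tendsto_sub {u v : ℕ → ℝ} {B : ℝ} (hu : ∀ n, |u n| ≤ B)
    (hv : ∀ n, |v n| ≤ B) (h : Tendsto (fun n => u n - v n) atTop (𝓝 0)) :
    liminf u atTop ≤ liminf v atTop := by
  have bu : IsBoundedUnder (· ≤ ·) atTop v := isBoundedUnder_of ⟨B, fun n => (abs_le.1 (hv n)).2⟩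
  have bl : IsBoundedUnder (· ≥ ·) atTop u := isBoundedUnder_of ⟨-B, fun n => (abs_le.1 (hu n)).1⟩
  refine le_of_forall_pos_le_add fun ε hε => ?_
  have hvε : ∀ᶠ n in atTop, liminf u atTop - ε / 2 < u n :=
    eventually_lt_of_lt_liminf (by linarith) bl
  rw [← sub_le_iff_le_add]
  refine le_liminf_of_le bu.isCoboundedUnder_ge ?_
  filter_upwards [hvε, h.eventually (gt_mem_nhds (half_pos hε))] with n h1 h2
  linarith

/-- Removing one factor changes the log-norm by a bounded amount, which the factor `1 / n` kills.
This is the `T`-invariance behind the existence of the exponents. -/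
theorem limsup_productRate_shift {C : ℝ} (h : ∀ k, ‖z k‖ ≤ C) :
    limsup (productRate fun k => z (k + 1)) atTop = limsup (productRate z) atTop := by
  obtain ⟨K, hK, hK'⟩ := exists_norm_transfer_le C
  have h1 := abs_productRate_le hK fun k => hK' _ (h k)
  have h2 := abs_productRate_le hK fun k => hK' _ (h (k + 1))
  have ht := tendsto_productRate_sub_shift h
  exact le_antisymm (limsup_le_limsup_of_tendsto_sub h2 h1 (by simpa using ht.neg))
    (limsup_le_limsup_of_tendsto_sub h1 h2 ht)

theorem liminf_productRate_shift {C : ℝ} (h : ∀ k, ‖z k‖ ≤ C) :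
    liminf (productRate fun k => z (k + 1)) atTop = liminf (productRate z) atTop := by
  obtain ⟨K, hK, hK'⟩ := exists_norm_transfer_le C
  have h1 := abs_productRate_le hK fun k => hK' _ (h k)
  have h2 := abs_productRate_le hK fun k => hK' _ (h (k + 1))
  have ht := tendsto_productRate_sub_shift h
  exact le_antisymm (liminf_le_liminf_of_tendsto_sub h2 h1 (by simpa using ht.neg))
    (liminf_le_liminf_of_tendsto_sub h1 h2 ht)

end Bounds

/-! ### Log-norms of hyperbolic products. -/

section Hyperbolic

theorem exists_norm_matrix_le :
    ∃ c : ℝ, 0 < c ∧ ∀ (A : Matrix (Fin 2) (Fin 2) ℂ) (B : ℝ), (∀ i j, ‖A i j‖ ≤ B) →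
      ‖A‖ ≤ c * B := by
  refine ⟨1 + ∑ i : Fin 2, ∑ j : Fin 2, ‖(Matrix.single i j 1 : Matrix (Fin 2) (Fin 2) ℂ)‖,
    by positivity, fun A B h => ?_⟩
  have hB : 0 ≤ B := (norm_nonneg _).trans (h 0 0)
  have hA : A = ∑ i : Fin 2, ∑ j : Fin 2, A i j • Matrix.single i j (1 : ℂ) := by
    conv_lhs => rw [Matrix.matrix_eq_sum_single A]
    simp
  calc ‖A‖ = ‖∑ i : Fin 2, ∑ j : Fin 2, A i j • Matrix.single i j (1 : ℂ)‖ := by rw [← hA]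
    _ ≤ ∑ i : Fin 2, ∑ j : Fin 2, B * ‖(Matrix.single i j 1 : Matrix (Fin 2) (Fin 2) ℂ)‖ := by
        refine norm_sum_le_of_le _ fun i _ => norm_sum_le_of_le _ fun j _ => ?_
        rw [norm_smul]
        gcongr
        exact h i j
    _ ≤ _ := by
        simp_rw [← Finset.mul_sum]
        nlinarith

theorem norm_apply_zero_zero_le (A : Matrix (Fin 2) (Fin 2) ℂ) : ‖A 0 0‖ ≤ ‖A‖ := by
  have h := Matrix.l2_opNorm_mulVec A (EuclideanSpace.single 0 1)
  rw [PiLp.norm_single, norm_one, mul_one] at h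
  refine le_trans (le_trans (le_of_eq ?_) (PiLp.norm_apply_le _ 0)) h
  simp

variable {z : ℕ → ℂ} {κ : ℝ}

theorem transferProduct_succ_zero (z : ℕ → ℂ) (n : ℕ) (j : Fin 2) :
    transferProduct z (n + 1) 0 j = z n * transferProduct z n 0 j - transferProduct z n 1 j := by
  simp [transferProduct, Matrix.mul_apply, Fin.sum_univ_two, sub_eq_add_neg]

theorem transferProduct_succ_one (z : ℕ → ℂ) (n : ℕ) (j : Fin 2) :
    transferProduct z (n + 1) 1 j = transferProduct z n 0 j := by
  simp [transferProduct, Matrix.mul_apply, Fin.sum_univ_two]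

/-- The cone of vectors whose first entry is at least `κ` times the second in modulus is invariant
when `|z| ≥ κ + 1/κ`; inside it, each step multiplies the first entry by at least `|z| - 1/κ ≥ κ`.
-/
theorem norm_transferProduct_entries_ge (hκ : 1 ≤ κ) (h : ∀ k, κ + 1 / κ ≤ ‖z k‖) (n : ℕ) :
    (∏ k ∈ Finset.range n, (‖z k‖ - 1 / κ)) ≤ ‖transferProduct z n 0 0‖ ∧
      κ * ‖transferProduct z n 1 0‖ ≤ ‖transferProduct z n 0 0‖ := by
  have hκ0 : 0 < κ := by linarith
  induction n with
  | zero => simp [transferProduct]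
  | succ n ih =>
    obtain ⟨h1, h2⟩ := ih
    have h3 : ‖transferProduct z n 1 0‖ ≤ 1 / κ * ‖transferProduct z n 0 0‖ := by
      rw [one_div, inv_mul_eq_div, le_div_iff₀ hκ0]
      linarith
    have h4 : (‖z n‖ - 1 / κ) * ‖transferProduct z n 0 0‖ ≤ ‖transferProduct z (n + 1) 0 0‖ := by
      rw [transferProduct_succ_zero]
      refine le_trans ?_ (norm_sub_norm_le _ _)
      rw [norm_mul]
      linarith
    have h5 := h n
    refine ⟨?_, ?_⟩
    · rw [Finset.prod_range_succ, mul_comm]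
      refine le_trans ?_ h4
      gcongr
      linarith
    · rw [transferProduct_succ_one]
      refine le_trans ?_ h4
      gcongr
      linarith

/-- In the weighted norm `max (|u 0|) (κ |u 1|)` a step expands by at most `|z| + 1/κ`; the leading
`κ` bounds this norm on the basis vectors. -/
theorem norm_transferProduct_entries_le (hκ : 1 ≤ κ) (h : ∀ k, κ + 1 / κ ≤ ‖z k‖) (n : ℕ)
    (j : Fin 2) :
    ‖transferProduct z n 0 j‖ ≤ κ * ∏ k ∈ Finset.range n, (‖z k‖ + 1 / κ) ∧
      κ * ‖transferProduct z n 1 j‖ ≤ κ * ∏ k ∈ Finset.range n, (‖z k‖ + 1 / κ) := by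
  have hκ0 : 0 < κ := by linarith
  induction n with
  | zero => rcases (by omega : j = 0 ∨ j = 1) with rfl | rfl <;> simp [transferProduct, hκ0.le, hκ]
  | succ n ih =>
    obtain ⟨h1, h2⟩ := ih
    have h5 := h n
    have hi : 0 < 1 / κ := by positivity
    rw [Finset.prod_range_succ]
    set Q := ∏ k ∈ Finset.range n, (‖z k‖ + 1 / κ)
    have h3 : ‖transferProduct z n 1 j‖ ≤ 1 / κ * (κ * Q) := by
      rw [one_div, inv_mul_eq_div, le_div_iff₀ hκ0]
      linarith
    have hQ : 0 ≤ κ * Q := (norm_nonneg _).trans h1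
    constructor
    · rw [transferProduct_succ_zero]
      refine (norm_sub_le _ _).trans ?_
      rw [norm_mul]
      have := mul_le_mul_of_nonneg_left h1 (norm_nonneg (z n))
      nlinarith
    · rw [transferProduct_succ_one]
      have := mul_le_mul_of_nonneg_left h1 hκ0.le
      nlinarith

theorem log_transferProduct_ge (hκ : 1 ≤ κ) (h : ∀ k, κ + 1 / κ ≤ ‖z k‖) (n : ℕ) :
    (∑ k ∈ Finset.range n, Real.log ‖z k‖) - n * (1 / κ ^ 2) ≤
      Real.log ‖transferProduct z n‖ := by
  have hκ0 : 0 < κ := by linarith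
  have hi : 0 < 1 / κ := by positivity
  have hpos : ∀ k, 0 < ‖z k‖ - 1 / κ := fun k => by have := h k; linarith
  -- By `log t ≤ t - 1` the loss is at most `(1/κ) / (|z| - 1/κ)`, whose denominator is at least
  -- `κ`.
  have hstep : ∀ k, Real.log ‖z k‖ - 1 / κ ^ 2 ≤ Real.log (‖z k‖ - 1 / κ) := fun k => by
    have hk := h k
    have h1 := Real.log_le_sub_one_of_pos
      (div_pos (by linarith : 0 < ‖z k‖) (hpos k))
    rw [Real.log_div (by linarith) (hpos k).ne'] at h1
    have h2 : ‖z k‖ / (‖z k‖ - 1 / κ) - 1 ≤ 1 / κ ^ 2 := by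
      rw [div_sub_one (hpos k).ne', div_le_iff₀ (hpos k)]
      have : (1 / κ ^ 2) * κ ≤ 1 / κ ^ 2 * (‖z k‖ - 1 / κ) := by gcongr; linarith
      have e : (1 / κ ^ 2) * κ = 1 / κ := by field_simp
      linarith
    linarith
  calc (∑ k ∈ Finset.range n, Real.log ‖z k‖) - n * (1 / κ ^ 2)
      = ∑ k ∈ Finset.range n, (Real.log ‖z k‖ - 1 / κ ^ 2) := by simp
    _ ≤ ∑ k ∈ Finset.range n, Real.log (‖z k‖ - 1 / κ) := Finset.sum_le_sum fun k _ => hstep k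
    _ = Real.log (∏ k ∈ Finset.range n, (‖z k‖ - 1 / κ)) :=
        (Real.log_prod fun k _ => (hpos k).ne').symm
    _ ≤ _ := Real.log_le_log (Finset.prod_pos fun k _ => hpos k)
        ((norm_transferProduct_entries_ge hκ h n).1.trans (norm_apply_zero_zero_le _))

theorem exists_log_transferProduct_le (hκ : 1 ≤ κ) (h : ∀ k, κ + 1 / κ ≤ ‖z k‖) :
    ∃ c : ℝ, ∀ n : ℕ, Real.log ‖transferProduct z n‖ ≤
      c + (∑ k ∈ Finset.range n, Real.log ‖z k‖) + n * (1 / κ ^ 2) := by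
  have hκ0 : 0 < κ := by linarith
  have hi : 0 < 1 / κ := by positivity
  obtain ⟨c, hc, hbound⟩ := exists_norm_matrix_le
  refine ⟨Real.log (c * κ), fun n => ?_⟩
  have hpos : ∀ k, 0 < ‖z k‖ := fun k => by have := h k; linarith
  have hstep : ∀ k, Real.log (‖z k‖ + 1 / κ) ≤ Real.log ‖z k‖ + 1 / κ ^ 2 := fun k => by
    have hk := h k
    have hs : 0 < ‖z k‖ + 1 / κ := by linarith
    have h1 := Real.log_le_sub_one_of_pos (div_pos hs (hpos k))
    rw [Real.log_div hs.ne' (hpos k).ne'] at h1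
    have h2 : (‖z k‖ + 1 / κ) / ‖z k‖ - 1 ≤ 1 / κ ^ 2 := by
      rw [div_sub_one (hpos k).ne', div_le_iff₀ (hpos k)]
      have : (1 / κ ^ 2) * κ ≤ 1 / κ ^ 2 * ‖z k‖ := by gcongr; linarith
      have e : (1 / κ ^ 2) * κ = 1 / κ := by field_simp
      linarith
    linarith
  set Q := ∏ k ∈ Finset.range n, (‖z k‖ + 1 / κ) with hQdef
  have hQ : 0 < Q := Finset.prod_pos fun k _ => by have := hpos k; linarith
  have hle : ‖transferProduct z n‖ ≤ c * κ * Q := by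
    rw [mul_assoc]
    refine hbound _ _ fun i j => ?_
    obtain ⟨h1, h2⟩ := norm_transferProduct_entries_le hκ h n j
    fin_cases i
    · exact h1
    · refine le_trans ?_ h2
      exact le_mul_of_one_le_left (norm_nonneg _) hκ
  calc Real.log ‖transferProduct z n‖ ≤ Real.log (c * κ * Q) :=
        Real.log_le_log (norm_pos_iff.2 (transferProduct_ne_zero _ _)) hle
    _ = Real.log (c * κ) + ∑ k ∈ Finset.range n, Real.log (‖z k‖ + 1 / κ) := by
        rw [Real.log_mul (by positivity) hQ.ne', hQdef,
          Real.log_prod fun k _ => by have := hpos k; positivity]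
    _ ≤ Real.log (c * κ) + ∑ k ∈ Finset.range n, (Real.log ‖z k‖ + 1 / κ ^ 2) := by
        gcongr with k
        exact hstep k
    _ = _ := by
        rw [Finset.sum_add_distrib]
        simp
        ring

end Hyperbolic

/-! ### Growth rates when the diagonal moduli take two values. -/

section TwoValued

variable {z : ℕ → ℂ} {g : ℕ → ℝ} {e : ℝ}

/-- A function of a sign is affine, so the sum of logarithms depends only on `n` and the sum of the
signs. -/
theorem sum_log_norm_eq (hg : ∀ k, g k = 1 ∨ g k = -1) (hz : ∀ k, ‖z k‖ = e - g k) (n : ℕ) :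
    ∑ k ∈ Finset.range n, Real.log ‖z k‖ =
      n * ((Real.log (e + 1) + Real.log (e - 1)) / 2) -
        (Real.log (e + 1) - Real.log (e - 1)) / 2 * ∑ k ∈ Finset.range n, g k := by
  have h : ∀ k, Real.log ‖z k‖ = (Real.log (e + 1) + Real.log (e - 1)) / 2 -
      (Real.log (e + 1) - Real.log (e - 1)) / 2 * g k := fun k => by
    rw [hz]
    rcases hg k with h | h <;> rw [h]
    · ring
    · rw [sub_neg_eq_add]; ring
  simp_rw [h]
  rw [Finset.sum_sub_distrib, ← Finset.mul_sum]
  simp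

/-- From `log t ≥ 1 - 1/t` at `t = (e + 1) / (e - 1)`, it is enough that `32 / e² < 2 / (e + 1)`,
that is `16 (e + 1) < e²`, which the threshold `18` ensures. -/
theorem log_gap (he : 18 < e) :
    4 * (1 / (e / 2) ^ 2) < (Real.log (e + 1) - Real.log (e - 1)) / 2 := by
  have h1 := Real.one_sub_inv_le_log_of_pos (div_pos (by linarith : 0 < e + 1)
    (by linarith : 0 < e - 1))
  rw [Real.log_div (by linarith) (by linarith)] at h1
  have h2 : 1 - ((e + 1) / (e - 1))⁻¹ = 2 / (e + 1) := by
    have : e + 1 ≠ 0 := by linarith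
    have : e - 1 ≠ 0 := by linarith
    field_simp
    ring
  have h3 : 8 * (1 / (e / 2) ^ 2) < 2 / (e + 1) := by
    rw [show 8 * (1 / (e / 2) ^ 2) = 32 / e ^ 2 by field_simp; ring,
      div_lt_div_iff₀ (by positivity) (by linarith)]
    nlinarith
  linarith

theorem half_add_le (he : 18 < e) (hg : ∀ k, g k = 1 ∨ g k = -1) (hz : ∀ k, ‖z k‖ = e - g k)
    (k : ℕ) : e / 2 + 1 / (e / 2) ≤ ‖z k‖ := by
  have h1 : 1 / (e / 2) ≤ 1 := by
    rw [div_le_one (by linarith)]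
    linarith
  rw [hz]
  rcases hg k with h | h <;> rw [h] <;> linarith

/-- The growth rate of the product with `‖z k‖ = e ∓ 1`, when the excess of the smaller value
is bounded and its deficit is frequently linear. -/
theorem productRate_lower (he : 18 < e) (hg : ∀ k, g k = 1 ∨ g k = -1)
    (hz : ∀ k, ‖z k‖ = e - g k) {C : ℝ} (hC : ∀ n, ∑ k ∈ Finset.range n, g k ≤ C)
    (hfreq : ∃ᶠ n : ℕ in atTop, ∑ k ∈ Finset.range n, g k ≤ -(n / 2 : ℝ)) :
    (Real.log (e + 1) + Real.log (e - 1)) / 2 - 1 / (e / 2) ^ 2 ≤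
        liminf (productRate z) atTop ∧
      (Real.log (e + 1) + Real.log (e - 1)) / 2 - 1 / (e / 2) ^ 2 +
        (Real.log (e + 1) - Real.log (e - 1)) / 4 ≤ limsup (productRate z) atTop := by
  set a := (Real.log (e + 1) + Real.log (e - 1)) / 2 with ha
  set δ := 1 / (e / 2) ^ 2 with hδ
  obtain ⟨B, hB⟩ := productRate_isBounded (z := z) (C := e + 1) fun k => by
    rw [hz]; rcases hg k with h | h <;> rw [h] <;> linarith
  have bu : IsBoundedUnder (· ≤ ·) atTop (productRate z) :=
    isBoundedUnder_of ⟨B, fun n => (abs_le.1 (hB n)).2⟩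
  have hb : 0 < (Real.log (e + 1) - Real.log (e - 1)) / 2 :=
    lt_trans (by positivity) (log_gap he)
  set b := (Real.log (e + 1) - Real.log (e - 1)) / 2 with hbdef
  have key : ∀ n : ℕ, 0 < n →
      a - δ - b * (∑ k ∈ Finset.range n, g k) / n ≤ productRate z n := fun n hn => by
    have hn' : (0 : ℝ) < n := by exact_mod_cast hn
    have h1 := log_transferProduct_ge (κ := e / 2) (by linarith) (half_add_le he hg hz) n
    rw [sum_log_norm_eq hg hz, ← ha, ← hδ, ← hbdef] at h1
    rw [productRate, one_div, inv_mul_eq_div, le_div_iff₀ hn']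
    refine le_trans (le_of_eq ?_) h1
    field_simp
    ring
  constructor
  · refine le_of_forall_pos_le_add fun ε hε => ?_
    rw [← sub_le_iff_le_add]
    refine le_liminf_of_le bu.isCoboundedUnder_ge ?_
    have hlim : Tendsto (fun n : ℕ => (b * C) / (n : ℝ)) atTop (𝓝 0) :=
      tendsto_const_div_atTop_nhds_zero_nat _
    filter_upwards [hlim.eventually (gt_mem_nhds hε), eventually_gt_atTop 0] with n h1 h2
    have h3 : b * (∑ k ∈ Finset.range n, g k) / n ≤ b * C / n := by
      gcongr
      exact hC n
    have := key n h2
    linarith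
  · refine le_limsup_of_frequently_le ?_ bu
    refine (hfreq.and_eventually (eventually_gt_atTop 0)).mono fun n ⟨h1, h2⟩ => ?_
    have hn' : (0 : ℝ) < n := by exact_mod_cast h2
    have h3 : b * (∑ k ∈ Finset.range n, g k) / n ≤ - (b / 2) := by
      rw [div_le_iff₀ hn']
      nlinarith
    have := key n h2
    have e' : (Real.log (e + 1) - Real.log (e - 1)) / 4 = b / 2 := by rw [hbdef]; ring
    linarith

theorem productRate_upper (he : 18 < e) (hg : ∀ k, g k = 1 ∨ g k = -1)
    (hz : ∀ k, ‖z k‖ = e - g k) {C : ℝ} (hC : ∀ n, -C ≤ ∑ k ∈ Finset.range n, g k)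
    (hfreq : ∃ᶠ n : ℕ in atTop, (n / 2 : ℝ) ≤ ∑ k ∈ Finset.range n, g k) :
    limsup (productRate z) atTop ≤
        (Real.log (e + 1) + Real.log (e - 1)) / 2 + 1 / (e / 2) ^ 2 ∧
      liminf (productRate z) atTop ≤
        (Real.log (e + 1) + Real.log (e - 1)) / 2 + 1 / (e / 2) ^ 2 -
          (Real.log (e + 1) - Real.log (e - 1)) / 4 := by
  set a := (Real.log (e + 1) + Real.log (e - 1)) / 2 with ha
  set δ := 1 / (e / 2) ^ 2 with hδ
  obtain ⟨B, hB⟩ := productRate_isBounded (z := z) (C := e + 1) fun k => by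
    rw [hz]; rcases hg k with h | h <;> rw [h] <;> linarith
  have bl : IsBoundedUnder (· ≥ ·) atTop (productRate z) :=
    isBoundedUnder_of ⟨-B, fun n => (abs_le.1 (hB n)).1⟩
  have hb : 0 < (Real.log (e + 1) - Real.log (e - 1)) / 2 :=
    lt_trans (by positivity) (log_gap he)
  set b := (Real.log (e + 1) - Real.log (e - 1)) / 2 with hbdef
  obtain ⟨c, hc⟩ := exists_log_transferProduct_le (κ := e / 2) (by linarith)
    (half_add_le he hg hz)
  have key : ∀ n : ℕ, 0 < n →
      productRate z n ≤ a + δ + c / n - b * (∑ k ∈ Finset.range n, g k) / n := fun n hn => by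
    have hn' : (0 : ℝ) < n := by exact_mod_cast hn
    have h1 := hc n
    rw [sum_log_norm_eq hg hz, ← ha, ← hδ, ← hbdef] at h1
    rw [productRate, one_div, inv_mul_eq_div, div_le_iff₀ hn']
    refine h1.trans (le_of_eq ?_)
    field_simp
    ring
  constructor
  · refine le_of_forall_pos_le_add fun ε hε => ?_
    refine limsup_le_of_le bl.isCoboundedUnder_le ?_
    have hlim : Tendsto (fun n : ℕ => (c + b * C) / (n : ℝ)) atTop (𝓝 0) :=
      tendsto_const_div_atTop_nhds_zero_nat _
    filter_upwards [hlim.eventually (gt_mem_nhds hε), eventually_gt_atTop 0] with n h1 h2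
    have h3 : b * (-C) / n ≤ b * (∑ k ∈ Finset.range n, g k) / n := by
      gcongr
      exact hC n
    have := key n h2
    rw [add_div] at h1
    rw [mul_neg, neg_div] at h3
    linarith
  · refine le_of_forall_pos_le_add fun ε hε => ?_
    refine liminf_le_of_frequently_le ?_ bl
    have hlim : Tendsto (fun n : ℕ => c / (n : ℝ)) atTop (𝓝 0) :=
      tendsto_const_div_atTop_nhds_zero_nat _
    refine (hfreq.and_eventually ((hlim.eventually (gt_mem_nhds hε)).and
      (eventually_gt_atTop 0))).mono fun n ⟨h1, h4, h2⟩ => ?_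
    have hn' : (0 : ℝ) < n := by exact_mod_cast h2
    have h3 : b / 2 ≤ b * (∑ k ∈ Finset.range n, g k) / n := by
      rw [le_div_iff₀ hn']
      nlinarith
    have := key n h2
    have e' : (Real.log (e + 1) - Real.log (e - 1)) / 4 = b / 2 := by rw [hbdef]; ring
    linarith

/-- Comparison of two products whose sign sequences have opposite fluctuations. -/
theorem productRate_lt (he : 18 < e) {z' : ℕ → ℂ} {g' : ℕ → ℝ}
    (hg : ∀ k, g k = 1 ∨ g k = -1) (hz : ∀ k, ‖z k‖ = e - g k)
    (hg' : ∀ k, g' k = 1 ∨ g' k = -1) (hz' : ∀ k, ‖z' k‖ = e - g' k)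
    {C : ℝ} (hC : ∀ n, ∑ k ∈ Finset.range n, g k ≤ C)
    (hfreq : ∃ᶠ n : ℕ in atTop, ∑ k ∈ Finset.range n, g k ≤ -(n / 2 : ℝ))
    (hC' : ∀ n, -C ≤ ∑ k ∈ Finset.range n, g' k)
    (hfreq' : ∃ᶠ n : ℕ in atTop, (n / 2 : ℝ) ≤ ∑ k ∈ Finset.range n, g' k) :
    limsup (productRate z') atTop < limsup (productRate z) atTop ∧
      liminf (productRate z') atTop < liminf (productRate z) atTop := by
  obtain ⟨h1, h2⟩ := productRate_lower he hg hz hC hfreq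
  obtain ⟨h3, h4⟩ := productRate_upper he hg' hz' hC' hfreq'
  -- Both comparisons amount to `2δ < b/2`.
  have := log_gap he
  constructor <;> linarith

end TwoValued

/-! ### Kakutani towers: invariance, ergodicity, conservativity. -/

section Skyscraper

variable {X : Type*} [MeasurableSpace X]

theorem measurableSet_below {φ : X → ℕ} (hφ : Measurable φ) :
    MeasurableSet {p : X × ℕ | p.2 < φ p.1} :=
  measurableSet_lt measurable_snd (hφ.comp measurable_fst)

/-- The skyscraper (Kakutani tower) transformation over `S` with height function `φ`, extended by
the identity above the tower. -/
def skyscraper (S : X ≃ᵐ X) (φ : X → ℕ) (hφ : Measurable φ) (hpos : ∀ x, 0 < φ x) :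
    X × ℕ ≃ᵐ X × ℕ where
  toFun p := if p.2 + 1 < φ p.1 then (p.1, p.2 + 1) else
    if p.2 + 1 = φ p.1 then (S p.1, 0) else p
  invFun p := if φ p.1 ≤ p.2 then p else
    if p.2 = 0 then (S.symm p.1, φ (S.symm p.1) - 1) else (p.1, p.2 - 1)
  left_inv := by
    rintro ⟨x, j⟩
    have := hpos (S x)
    by_cases h1 : j + 1 < φ x
    · simp [h1]
    · by_cases h2 : j + 1 = φ x
      · simp [this.ne', ← h2]
      · have h3 : φ x ≤ j := by omega
        simp [h1, h2, h3]
  right_inv := by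
    rintro ⟨x, j⟩
    have := hpos (S.symm x)
    by_cases h1 : φ x ≤ j
    · have h2 : ¬ j + 1 < φ x := by omega
      have h3 : ¬ j + 1 = φ x := by omega
      simp [h1, h2, h3]
    · by_cases h2 : j = 0
      · subst h2
        have h3 : φ (S.symm x) - 1 + 1 = φ (S.symm x) := by omega
        simp [h1, h3]
      · have h3 : j - 1 + 1 = j := by omega
        simp [h1, h2, h3, not_le.1 h1]
  measurable_toFun := by
    refine Measurable.ite ?_ (by fun_prop) (Measurable.ite ?_ (by fun_prop) measurable_id)
    · exact measurableSet_lt (by fun_prop) (by fun_prop)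
    · exact measurableSet_eq_fun (by fun_prop) (by fun_prop)
  measurable_invFun := by
    refine Measurable.ite ?_ measurable_id (Measurable.ite ?_ (by fun_prop) (by fun_prop))
    · exact measurableSet_le (by fun_prop) (by fun_prop)
    · exact measurable_snd (measurableSet_singleton 0)

/-- The measure on the tower with base measure `ν`. -/
noncomputable def skyscraperMeasure (ν : Measure X) (φ : X → ℕ) : Measure (X × ℕ) :=
  (ν.prod Measure.count).restrict {p | p.2 < φ p.1}

instance (ν : Measure X) [SigmaFinite ν] (φ : X → ℕ) : SigmaFinite (skyscraperMeasure ν φ) := by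
  unfold skyscraperMeasure
  infer_instance

variable {S : X ≃ᵐ X} {φ : X → ℕ} {hφ : Measurable φ} {hpos : ∀ x, 0 < φ x}

theorem skyscraper_of_lt {x : X} {j : ℕ} (h : j + 1 < φ x) :
    skyscraper S φ hφ hpos (x, j) = (x, j + 1) := if_pos h

theorem skyscraper_of_eq {x : X} {j : ℕ} (h : j + 1 = φ x) :
    skyscraper S φ hφ hpos (x, j) = (S x, 0) := by
  have h' : ¬ j + 1 < φ x := by omega
  exact (if_neg h').trans (if_pos h)

theorem skyscraper_iterate_zero {x : X} {j : ℕ} (h : j < φ x) :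
    (skyscraper S φ hφ hpos)^[j] (x, 0) = (x, j) := by
  induction j with
  | zero => rfl
  | succ j ih => rw [Function.iterate_succ_apply', ih (by omega), skyscraper_of_lt h]

theorem skyscraper_iterate_height (x : X) :
    (skyscraper S φ hφ hpos)^[φ x] (x, 0) = (S x, 0) := by
  obtain ⟨j, hj⟩ := Nat.exists_eq_succ_of_ne_zero (hpos x).ne'
  rw [hj, Function.iterate_succ_apply', skyscraper_iterate_zero (by omega),
    skyscraper_of_eq hj.symm]

theorem skyscraper_iterate_sum (x : X) (n : ℕ) :
    (skyscraper S φ hφ hpos)^[∑ i ∈ Finset.range n, φ (S^[i] x)] (x, 0) = (S^[n] x, 0) := by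
  induction n with
  | zero => rfl
  | succ n ih =>
    rw [Finset.sum_range_succ, Nat.add_comm, Function.iterate_add_apply, ih,
      skyscraper_iterate_height, Function.iterate_succ_apply']

variable {ν : Measure X}

theorem skyscraperMeasure_apply [SFinite ν] (hφ : Measurable φ) {s : Set (X × ℕ)}
    (hs : MeasurableSet s) :
    skyscraperMeasure ν φ s = ∑' j, ν {x | j < φ x ∧ (x, j) ∈ s} := by
  rw [skyscraperMeasure, Measure.restrict_apply hs,
    Measure.prod_apply_symm (hs.inter (measurableSet_below hφ)), lintegral_count]
  congr 1
  ext j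
  congr 1
  ext x
  exact and_comm

/-- Points of level `j` either rise to level `j + 1` or, at the top of their column, return to the
base through `S`. Summed over `j`, the return parts recover the measure of the base slice, which
proves invariance. -/
theorem setOf_skyscraper_preimage (s : Set (X × ℕ)) (j : ℕ) :
    {x | j < φ x ∧ (x, j) ∈ skyscraper S φ hφ hpos ⁻¹' s} =
      {x | j + 1 < φ x ∧ (x, j + 1) ∈ s} ∪ (S ⁻¹' {x | (x, 0) ∈ s} ∩ φ ⁻¹' {j + 1}) := by
  ext x
  simp only [Set.mem_preimage, Set.mem_union, Set.mem_inter_iff, Set.mem_singleton_iff,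
    Set.mem_ofPred_eq]
  rcases lt_trichotomy (j + 1) (φ x) with h | h | h
  · rw [skyscraper_of_lt h]
    have h1 : j < φ x := by omega
    simp [h, h1, h.ne']
  · rw [skyscraper_of_eq h]
    simp [h.symm]
  · have h1 : ¬ j < φ x := by omega
    have h2 : ¬ j + 1 < φ x := by omega
    simp [h1, h2, h.ne]

theorem measurableSet_skyscraper_return (hφ : Measurable φ) {s : Set X} (hs : MeasurableSet s)
    (j : ℕ) : MeasurableSet (S ⁻¹' s ∩ φ ⁻¹' {j + 1}) :=
  (S.measurable hs).inter (hφ (measurableSet_singleton _))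

theorem tsum_measure_skyscraper_return (hφ : Measurable φ) (hpos : ∀ x, 0 < φ x)
    (hS : MeasurePreserving S ν ν) {s : Set X} (hs : MeasurableSet s) :
    ∑' j, ν (S ⁻¹' s ∩ φ ⁻¹' {j + 1}) = ν s := by
  have h1 : ⋃ j, S ⁻¹' s ∩ φ ⁻¹' {j + 1} = S ⁻¹' s := by
    ext x
    simp only [Set.mem_iUnion, Set.mem_inter_iff, Set.mem_preimage, Set.mem_singleton_iff,
      exists_and_left, and_iff_left_iff_imp]
    exact fun _ => ⟨φ x - 1, by have := hpos x; omega⟩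
  rw [← measure_iUnion _ (measurableSet_skyscraper_return hφ hs), h1,
    hS.measure_preimage hs.nullMeasurableSet]
  intro i j hij
  refine Disjoint.mono Set.inter_subset_right Set.inter_subset_right ?_
  exact Disjoint.preimage _ (by simpa using hij)

theorem measure_setOf_skyscraper_preimage (hφ : Measurable φ) {s : Set (X × ℕ)}
    (hs : MeasurableSet {x : X | (x, 0) ∈ s}) (j : ℕ) :
    ν {x | j < φ x ∧ (x, j) ∈ skyscraper S φ hφ hpos ⁻¹' s} =
      ν {x | j + 1 < φ x ∧ (x, j + 1) ∈ s} + ν (S ⁻¹' {x | (x, 0) ∈ s} ∩ φ ⁻¹' {j + 1}) := by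
  have hd : Disjoint {x | j + 1 < φ x ∧ (x, j + 1) ∈ s}
      (S ⁻¹' {x | (x, 0) ∈ s} ∩ φ ⁻¹' {j + 1}) := by
    rw [Set.disjoint_left]
    intro x hx hx'
    simp only [Set.mem_ofPred_eq, Set.mem_inter_iff, Set.mem_preimage,
      Set.mem_singleton_iff] at hx hx'
    omega
  rw [setOf_skyscraper_preimage,
    measure_union hd (measurableSet_skyscraper_return hφ hs j)]

theorem skyscraperMeasure_preimage [SFinite ν] (hS : MeasurePreserving S ν ν) {s : Set (X × ℕ)}
    (hs : MeasurableSet s) :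
    skyscraperMeasure ν φ (skyscraper S φ hφ hpos ⁻¹' s) = skyscraperMeasure ν φ s := by
  have hs0 : MeasurableSet {x : X | (x, 0) ∈ s} := (by fun_prop : Measurable fun x : X => (x, 0)) hs
  have h0 : {x | 0 < φ x ∧ (x, 0) ∈ s} = {x | (x, 0) ∈ s} := by simp [hpos]
  calc skyscraperMeasure ν φ (skyscraper S φ hφ hpos ⁻¹' s)
      = ∑' j, ν {x | j < φ x ∧ (x, j) ∈ skyscraper S φ hφ hpos ⁻¹' s} :=
        skyscraperMeasure_apply hφ ((skyscraper S φ hφ hpos).measurable hs)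
    _ = ∑' j, (ν {x | j + 1 < φ x ∧ (x, j + 1) ∈ s} +
          ν (S ⁻¹' {x | (x, 0) ∈ s} ∩ φ ⁻¹' {j + 1})) :=
        tsum_congr (measure_setOf_skyscraper_preimage hφ hs0)
    _ = ν {x | 0 < φ x ∧ (x, 0) ∈ s} + ∑' j, ν {x | j + 1 < φ x ∧ (x, j + 1) ∈ s} := by
        rw [ENNReal.tsum_add, tsum_measure_skyscraper_return hφ hpos hS hs0, add_comm, h0]
    _ = ∑' j, ν {x | j < φ x ∧ (x, j) ∈ s} :=
        (tsum_eq_zero_add' (f := fun j => ν {x | j < φ x ∧ (x, j) ∈ s}) ENNReal.summable).symm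
    _ = skyscraperMeasure ν φ s := (skyscraperMeasure_apply hφ hs).symm

theorem measurePreserving_skyscraper [SFinite ν] (hS : MeasurePreserving S ν ν) :
    MeasurePreserving (skyscraper S φ hφ hpos) (skyscraperMeasure ν φ)
      (skyscraperMeasure ν φ) := by
  constructor
  · exact (skyscraper S φ hφ hpos).measurable
  · ext s hs
    rw [Measure.map_apply (skyscraper S φ hφ hpos).measurable hs, skyscraperMeasure_preimage hS hs]

theorem ae_skyscraperMeasure_of_ae [SFinite ν] (hφ : Measurable φ) {p : X → Prop}
    (h : ∀ᵐ x ∂ν, p x) : ∀ᵐ ω ∂(skyscraperMeasure ν φ), ω.2 < φ ω.1 ∧ p ω.1 :=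
  (ae_restrict_mem (measurableSet_below hφ)).and
    (ae_restrict_of_ae (Measure.quasiMeasurePreserving_fst.ae h))

/-- An invariant set contains a whole column or none of it, so it is determined by its base slice,
which is `S`-invariant. -/
theorem ergodic_skyscraper [SFinite ν] (hS : Ergodic S ν) :
    Ergodic (skyscraper S φ hφ hpos) (skyscraperMeasure ν φ) := by
  refine ⟨measurePreserving_skyscraper hS.toMeasurePreserving, ⟨fun s hs hinv => ?_⟩⟩
  have hiter : ∀ (n : ℕ) (ω : X × ℕ), (skyscraper S φ hφ hpos)^[n] ω ∈ s ↔ ω ∈ s := fun n => by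
    induction n with
    | zero => exact fun _ => Iff.rfl
    | succ n ih =>
      intro ω
      rw [Function.iterate_succ_apply, ih, ← Set.mem_preimage, hinv]
  have hbase : ∀ x j, j < φ x → ((x, j) ∈ s ↔ (x, 0) ∈ s) := fun x j hj => by
    rw [← hiter j (x, 0), skyscraper_iterate_zero hj]
  have hs0 : MeasurableSet {x : X | (x, 0) ∈ s} := (by fun_prop : Measurable fun x : X => (x, 0)) hs
  have hinv0 : S ⁻¹' {x : X | (x, 0) ∈ s} = {x : X | (x, 0) ∈ s} := by
    ext x
    rw [Set.mem_preimage, Set.mem_ofPred_eq, Set.mem_ofPred_eq, ← hiter (φ x) (x, 0),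
      skyscraper_iterate_height]
  rcases eventuallyConst_set.1 (hS.aeconst_set hs0 hinv0) with h | h
  · exact eventuallyConst_set.2 <| .inl <|
      (ae_skyscraperMeasure_of_ae hφ h).mono fun ω hω => (hbase ω.1 ω.2 hω.1).2 hω.2
  · exact eventuallyConst_set.2 <| .inr <|
      (ae_skyscraperMeasure_of_ae hφ h).mono fun ω hω => fun hmem =>
        hω.2 ((hbase ω.1 ω.2 hω.1).1 hmem)

/-- The base measure is finite, so Poincaré recurrence applies to a level slice of positive measure;
a return of the base point after `m` steps lifts to a return in the tower after the sum of the `m`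
heights crossed. -/
theorem conservative_skyscraper [IsFiniteMeasure ν] (hS : MeasurePreserving S ν ν) :
    Conservative (skyscraper S φ hφ hpos) (skyscraperMeasure ν φ) := by
  refine ⟨(measurePreserving_skyscraper hS).quasiMeasurePreserving, fun s hs h0 => ?_⟩
  rw [skyscraperMeasure_apply hφ hs, Ne, ENNReal.tsum_eq_zero, not_forall] at h0
  obtain ⟨j, hj⟩ := h0
  have hsj : MeasurableSet {x | j < φ x ∧ (x, j) ∈ s} :=
    (measurableSet_lt measurable_const hφ).inter ((by fun_prop : Measurable fun x : X => (x, j)) hs)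
  obtain ⟨x, ⟨hx1, hx2⟩, m, hm, hx3, hx4⟩ := hS.conservative.exists_mem_iterate_mem' hsj hj
  refine ⟨(x, j), hx2, ∑ i ∈ Finset.range m, φ (S^[i] x), ?_, ?_⟩
  · have : φ (S^[0] x) ≤ ∑ i ∈ Finset.range m, φ (S^[i] x) :=
      Finset.single_le_sum (f := fun i => φ (S^[i] x)) (fun _ _ => Nat.zero_le _)
        (Finset.mem_range.2 (Nat.pos_of_ne_zero hm))
    have := hpos (S^[0] x)
    omega
  · rw [← skyscraper_iterate_zero (S := S) (hφ := hφ) (hpos := hpos) hx1,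
      ← Function.iterate_add_apply, Nat.add_comm, Function.iterate_add_apply,
      skyscraper_iterate_sum, skyscraper_iterate_zero hx3]
    exact hx4

end Skyscraper

/-! ### The coboundary and its extreme Birkhoff sums. -/

section Tent

variable {X : Type*}

/-- The distance of a point of the tower of height `2 * h` to the two ends of its column. -/
def tent (h : X → ℕ) (ω : X × ℕ) : ℝ := min (ω.2 : ℝ) (2 * h ω.1 - ω.2)

/-- The sampling function that is `-1` on the lower half of each column and `1` above. -/
def halfSign (h : X → ℕ) (ω : X × ℕ) : ℝ := if ω.2 < h ω.1 then -1 else 1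

theorem halfSign_eq (h : X → ℕ) (ω : X × ℕ) : halfSign h ω = 1 ∨ halfSign h ω = -1 := by
  unfold halfSign
  split_ifs <;> simp

theorem tent_nonneg {h : X → ℕ} {ω : X × ℕ} (hω : ω.2 < 2 * h ω.1) : 0 ≤ tent h ω := by
  have : (ω.2 : ℝ) ≤ 2 * h ω.1 := by exact_mod_cast hω.le
  exact le_min (by positivity) (by linarith)

theorem tent_le {h : X → ℕ} (ω : X × ℕ) : tent h ω ≤ ω.2 := min_le_left _ _

theorem tent_middle {h : X → ℕ} (x : X) : tent h (x, h x) = h x := by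
  rw [tent]
  simp only
  rw [show (2 * h x - h x : ℝ) = h x by ring, min_self]

theorem isSamplingFunction_halfSign [MeasurableSpace X] {h : X → ℕ} (hh : Measurable h) :
    IsSamplingFunction (halfSign h) where
  measurable := Measurable.ite (measurableSet_lt measurable_snd (hh.comp measurable_fst))
    measurable_const measurable_const
  bounded := ⟨1, fun ω => by rcases halfSign_eq h ω with h | h <;> simp [h]⟩

variable [MeasurableSpace X] {S : X ≃ᵐ X} {h : X → ℕ} {hφ : Measurable fun x => 2 * h x}
  {hpos : ∀ x, 0 < 2 * h x}

theorem skyscraper_mem {ω : X × ℕ} (hω : ω.2 < 2 * h ω.1) :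
    (skyscraper S _ hφ hpos ω).2 < 2 * h (skyscraper S _ hφ hpos ω).1 := by
  obtain ⟨x, j⟩ := ω
  simp only at hω
  rcases Nat.lt_or_ge (j + 1) (2 * h x) with h1 | h1
  · rw [skyscraper_of_lt (φ := fun x => 2 * h x) h1]
    exact h1
  · rw [skyscraper_of_eq (φ := fun x => 2 * h x) (by omega)]
    exact hpos _

theorem skyscraper_symm_mem {ω : X × ℕ} (hω : ω.2 < 2 * h ω.1) :
    ((skyscraper S _ hφ hpos).symm ω).2 < 2 * h ((skyscraper S _ hφ hpos).symm ω).1 := by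
  by_contra hcon
  -- A point above the tower is fixed, so it cannot be the preimage of a point of the tower.
  have h1 : skyscraper S _ hφ hpos ((skyscraper S _ hφ hpos).symm ω) =
      (skyscraper S _ hφ hpos).symm ω :=
    (if_neg (by simp only; omega)).trans (if_neg (by simp only; omega))
  rw [MeasurableEquiv.apply_symm_apply] at h1
  rw [← h1] at hcon
  exact hcon hω

theorem skyscraper_iterate_mem {ω : X × ℕ} (hω : ω.2 < 2 * h ω.1) (n : ℕ) :
    ((skyscraper S _ hφ hpos)^[n] ω).2 < 2 * h ((skyscraper S _ hφ hpos)^[n] ω).1 := by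
  induction n with
  | zero => exact hω
  | succ n ih =>
    rw [Function.iterate_succ_apply']
    exact skyscraper_mem ih

theorem skyscraper_symm_iterate_mem {ω : X × ℕ} (hω : ω.2 < 2 * h ω.1) (n : ℕ) :
    ((skyscraper S _ hφ hpos).symm^[n] ω).2 < 2 * h ((skyscraper S _ hφ hpos).symm^[n] ω).1 := by
  induction n with
  | zero => exact hω
  | succ n ih =>
    rw [Function.iterate_succ_apply']
    exact skyscraper_symm_mem ih

/-- `tent` climbs by one per step on the lower half and descends by one on the upper half, vanishing
on arrival at the next base. -/
theorem halfSign_eq_sub {ω : X × ℕ} (hω : ω.2 < 2 * h ω.1) :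
    halfSign h ω = tent h ω - tent h (skyscraper S _ hφ hpos ω) := by
  obtain ⟨x, j⟩ := ω
  simp only at hω
  rcases Nat.lt_or_ge (j + 1) (2 * h x) with h1 | h1
  · rw [skyscraper_of_lt (φ := fun x => 2 * h x) h1]
    rcases Nat.lt_or_ge j (h x) with h2 | h2
    · have h3 : (j : ℝ) + 1 ≤ h x := by exact_mod_cast h2
      simp only [halfSign, tent, h2, if_true]
      push_cast
      rw [min_eq_left (by linarith), min_eq_left (by linarith)]
      ring
    · have h3 : (h x : ℝ) ≤ j := by exact_mod_cast h2
      simp only [halfSign, tent, not_lt.2 h2, if_false]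
      push_cast
      rw [min_eq_right (by linarith), min_eq_right (by linarith)]
      ring
  · have h2 : j + 1 = 2 * h x := by omega
    rw [skyscraper_of_eq (φ := fun x => 2 * h x) h2]
    have h3 : h x ≤ j := by omega
    have h4 : (j : ℝ) + 1 = 2 * h x := by exact_mod_cast h2
    have h5 : (h x : ℝ) ≤ j := by exact_mod_cast h3
    simp only [halfSign, tent, not_lt.2 h3, if_false]
    push_cast
    rw [min_eq_right (by linarith), min_eq_left (by simp)]
    linarith

theorem sum_halfSign_forward {ω : X × ℕ} (hω : ω.2 < 2 * h ω.1) (n : ℕ) :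
    ∑ k ∈ Finset.range n, halfSign h ((skyscraper S _ hφ hpos)^[k] ω) =
      tent h ω - tent h ((skyscraper S _ hφ hpos)^[n] ω) := by
  induction n with
  | zero => simp
  | succ n ih =>
    rw [Finset.sum_range_succ, ih, Function.iterate_succ_apply',
      halfSign_eq_sub (S := S) (hφ := hφ) (hpos := hpos) (skyscraper_iterate_mem hω n)]
    ring

theorem sum_halfSign_backward {ω : X × ℕ} (hω : ω.2 < 2 * h ω.1) (n : ℕ) :
    ∑ k ∈ Finset.range n, halfSign h ((skyscraper S _ hφ hpos).symm^[k + 1] ω) =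
      tent h ((skyscraper S _ hφ hpos).symm^[n] ω) - tent h ω := by
  induction n with
  | zero => simp
  | succ n ih =>
    rw [Finset.sum_range_succ, ih,
      halfSign_eq_sub (S := S) (hφ := hφ) (hpos := hpos) (skyscraper_symm_iterate_mem hω (n + 1)),
      Function.iterate_succ_apply', MeasurableEquiv.apply_symm_apply]
    ring

theorem frequently_sum_halfSign_forward
    (hS : ∀ (x : X) (C : ℕ), ∃ n, C + ∑ i ∈ Finset.range n, 2 * h (S^[i] x) ≤ h (S^[n] x))
    {ω : X × ℕ} (hω : ω.2 < 2 * h ω.1) :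
    ∃ᶠ n : ℕ in atTop, ∑ k ∈ Finset.range n, halfSign h ((skyscraper S _ hφ hpos)^[k] ω) ≤
      -(n / 2 : ℝ) := by
  rw [frequently_atTop]
  intro N
  obtain ⟨n, hn⟩ := hS ω.1 (N + ω.2)
  -- The orbit reaches the middle of the column over `y` at time `Φ + h y - ω.2`, where the sum is
  -- `tent ω - h y`. This is at most minus half the time once `h y ≥ Φ + ω.2`; the extra `N` makes
  -- the time exceed `N`.
  set Φ := ∑ i ∈ Finset.range n, 2 * h (S^[i] ω.1) with hΦ
  set y := S^[n] ω.1 with hy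
  have hmid : h y < 2 * h y := by have := hpos y; omega
  have hit : (skyscraper S _ hφ hpos)^[Φ + h y - ω.2] ω = (y, h y) := by
    have h1 : (skyscraper S _ hφ hpos)^[Φ + h y - ω.2] ((skyscraper S _ hφ hpos)^[ω.2] (ω.1, 0)) =
        (y, h y) := by
      rw [← Function.iterate_add_apply, show Φ + h y - ω.2 + ω.2 = h y + Φ by omega,
        Function.iterate_add_apply, hΦ, skyscraper_iterate_sum]
      exact skyscraper_iterate_zero (φ := fun x => 2 * h x) hmid
    rwa [skyscraper_iterate_zero (φ := fun x => 2 * h x) hω] at h1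
  refine ⟨Φ + h y - ω.2, by omega, ?_⟩
  rw [sum_halfSign_forward hω, hit, tent_middle, Nat.cast_sub (by omega)]
  have h1 := tent_le (h := h) ω
  have h2 : ((N + ω.2 + Φ : ℕ) : ℝ) ≤ h y := by exact_mod_cast hn
  push_cast at h2 ⊢
  have h3 : (0 : ℝ) ≤ N := by positivity
  linarith

theorem skyscraper_symm_iterate_sum (x : X) (n : ℕ) :
    (skyscraper S _ hφ hpos).symm^[∑ i ∈ Finset.range n, 2 * h (S.symm^[i + 1] x)] (x, 0) =
      (S.symm^[n] x, 0) := by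
  have hinv : Function.LeftInverse (skyscraper S _ hφ hpos).symm (skyscraper S _ hφ hpos) :=
    (skyscraper S _ hφ hpos).symm_apply_apply
  induction n with
  | zero => rfl
  | succ n ih =>
    rw [Finset.sum_range_succ, Nat.add_comm, Function.iterate_add_apply, ih]
    have h1 := skyscraper_iterate_height (S := S) (hφ := hφ) (hpos := hpos) (S.symm^[n + 1] x)
    rw [Function.iterate_succ_apply', MeasurableEquiv.apply_symm_apply] at h1
    rw [Function.iterate_succ_apply', ← h1]
    exact hinv.iterate _ _

theorem frequently_sum_halfSign_backward
    (hS : ∀ (x : X) (C : ℕ), ∃ n,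
      C + ∑ i ∈ Finset.range n, 2 * h (S.symm^[i + 1] x) ≤ h (S.symm^[n + 1] x))
    {ω : X × ℕ} (hω : ω.2 < 2 * h ω.1) :
    ∃ᶠ n : ℕ in atTop, (n / 2 : ℝ) ≤
      ∑ k ∈ Finset.range n, halfSign h ((skyscraper S _ hφ hpos).symm^[k + 1] ω) := by
  rw [frequently_atTop]
  intro N
  -- Backward, the middle is reached at time `h y + Φ + ω.2` with sum `h y - tent ω`; being at least
  -- half the time requires `h y ≥ Φ + 3 * ω.2`.
  obtain ⟨n, hn⟩ := hS ω.1 (N + 3 * ω.2)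
  set Φ := ∑ i ∈ Finset.range n, 2 * h (S.symm^[i + 1] ω.1) with hΦ
  set y := S.symm^[n + 1] ω.1 with hy
  have hSy : S y = S.symm^[n] ω.1 := by
    rw [hy, Function.iterate_succ_apply', MeasurableEquiv.apply_symm_apply]
  have hinv : Function.LeftInverse (skyscraper S _ hφ hpos).symm (skyscraper S _ hφ hpos) :=
    (skyscraper S _ hφ hpos).symm_apply_apply
  have hmid : h y < 2 * h y := by have := hpos y; omega
  have h0 : (skyscraper S _ hφ hpos).symm^[ω.2] ω = (ω.1, 0) := by
    have := hinv.iterate ω.2 (ω.1, 0)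
    rwa [skyscraper_iterate_zero (φ := fun x => 2 * h x) hω] at this
  have htop : (skyscraper S _ hφ hpos).symm^[h y] (S y, 0) = (y, h y) := by
    rw [← skyscraper_iterate_height (hφ := hφ) (hpos := hpos), two_mul, Function.iterate_add_apply,
      hinv.iterate, skyscraper_iterate_zero (φ := fun x => 2 * h x) hmid]
  have hit : (skyscraper S _ hφ hpos).symm^[h y + (Φ + ω.2)] ω = (y, h y) := by
    rw [Function.iterate_add_apply, Function.iterate_add_apply, h0, hΦ,
      skyscraper_symm_iterate_sum, ← hSy, htop]
  refine ⟨h y + (Φ + ω.2), by omega, ?_⟩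
  rw [sum_halfSign_backward hω, hit, tent_middle]
  have h1 := tent_le (h := h) ω
  have h2 : ((N + 3 * ω.2 + Φ : ℕ) : ℝ) ≤ h y := by exact_mod_cast hn
  push_cast at h2 ⊢
  have h3 : (0 : ℝ) ≤ N := by positivity
  linarith

end Tent

/-! ### The 2-adic odometer and a tower of infinite measure. -/

section Odometer

/-- The integer part of `1 / ‖x‖` for a `2`-adic integer `x`. -/
noncomputable def invNorm (x : ℤ_[2]) : ℕ := ⌊‖x‖⁻¹⌋₊

/-- Half of the column height of the tower over the `2`-adic odometer. -/
noncomputable def columnHalf (x : ℤ_[2]) : ℕ := 2 ^ (invNorm x ^ 2)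

theorem columnHalf_neg (x : ℤ_[2]) : columnHalf (-x) = columnHalf x := by
  simp [columnHalf, invNorm]

theorem columnHalf_pos (x : ℤ_[2]) : 0 < 2 * columnHalf x := by
  unfold columnHalf
  positivity

/-- It suffices that `n ≡ -x` modulo `2^k`, except that `x + n = 0` must be avoided because `invNorm
0 = 0`. At most one `n` is excluded, so one of the two candidates `m + 2^k`, `m + 2 * 2^k` works. -/
theorem exists_le_invNorm_add (x : ℤ_[2]) (k : ℕ) :
    ∃ n : ℕ, 1 ≤ n ∧ n ≤ 3 * 2 ^ k ∧ 2 ^ k ≤ invNorm (x + n) := by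
  have key : ∀ n : ℕ, (n : ZMod (2 ^ k)) = ((-x).appr k : ℕ) → x + (n : ℤ_[2]) ≠ 0 →
      2 ^ k ≤ invNorm (x + n) := by
    intro n hn h0
    have h1 : -x - (-x).appr k ∈ Ideal.span {((2 : ℕ) : ℤ_[2]) ^ k} := PadicInt.appr_spec k (-x)
    have h2 : ((n : ℤ_[2]) - (-x).appr k) ∈ Ideal.span {((2 : ℕ) : ℤ_[2]) ^ k} := by
      have h3 := (ZMod.natCast_eq_natCast_iff _ _ _).1 hn
      obtain ⟨c, hc⟩ := (Nat.modEq_iff_dvd.1 h3.symm)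
      rw [Ideal.mem_span_singleton]
      refine ⟨c, ?_⟩
      have := congrArg (Int.cast : ℤ → ℤ_[2]) hc
      push_cast at this ⊢
      exact this
    have h4 : x + (n : ℤ_[2]) ∈ Ideal.span {((2 : ℕ) : ℤ_[2]) ^ k} := by
      have := Ideal.sub_mem _ h2 h1
      convert this using 1
      ring
    rw [← PadicInt.norm_le_pow_iff_mem_span_pow] at h4
    rw [invNorm]
    refine Nat.le_floor ?_
    have h5 : 0 < ‖x + (n : ℤ_[2])‖ := norm_pos_iff.2 h0
    rw [le_inv_comm₀ (by positivity) h5]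
    simpa using h4
  have hlt := PadicInt.appr_lt (-x) k
  have hp : 0 < 2 ^ k := by positivity
  set m := (-x).appr k
  by_cases h0 : x + ((m + 2 ^ k : ℕ) : ℤ_[2]) = 0
  · refine ⟨m + 2 * 2 ^ k, by omega, by omega, key _ (by simp) fun h1 => ?_⟩
    have h2 : ((2 ^ k : ℕ) : ℤ_[2]) = 0 := by
      push_cast at h0 h1 ⊢
      linear_combination h1 - h0
    exact hp.ne' (by exact_mod_cast h2)
  · exact ⟨m + 2 ^ k, by omega, by omega, key _ (by simp) h0⟩

/-- Take the first `n ≥ 1` with `invNorm (x + n) ≥ q + 1`, where `q + 1 = 2^(D + 2)`. There are at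
most `3 (q + 1)` earlier columns, of half-height at most `2^(q²)` apart from the one over `x`,
whereas the new half-height is at least `2^((q+1)²) = 2^(2q+1) * 2^(q²)`. The square in the exponent
makes the ratio beat the waiting time. -/
theorem exists_columnHalf_ge (x : ℤ_[2]) (C : ℕ) :
    ∃ n : ℕ, C + ∑ i ∈ Finset.range n, 2 * columnHalf (x + i) ≤ columnHalf (x + n) := by
  classical
  set D := C + 2 * columnHalf x with hD
  obtain ⟨q, hq⟩ : ∃ q, 2 ^ (D + 2) = q + 1 :=
    Nat.exists_eq_succ_of_ne_zero (by positivity)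
  have hex : ∃ n : ℕ, 1 ≤ n ∧ 2 ^ (D + 2) ≤ invNorm (x + n) := by
    obtain ⟨n, h1, -, h2⟩ := exists_le_invNorm_add x (D + 2)
    exact ⟨n, h1, h2⟩
  obtain ⟨hn1, hn2⟩ := Nat.find_spec hex
  have hmin : ∀ i, 1 ≤ i → i < Nat.find hex → invNorm (x + i) ≤ q := fun i hi hi' => by
    have := Nat.find_min hex hi'
    simp only [not_and, not_le] at this
    have := this hi
    omega
  have hle : Nat.find hex ≤ 3 * (q + 1) := by
    obtain ⟨n, h1, h3, h2⟩ := exists_le_invNorm_add x (D + 2)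
    rw [hq] at h3
    exact (Nat.find_min' hex ⟨h1, h2⟩).trans h3
  set n := Nat.find hex
  refine ⟨n, ?_⟩
  obtain ⟨m, hm⟩ := Nat.exists_eq_succ_of_ne_zero (by omega : n ≠ 0)
  have hsum : ∑ i ∈ Finset.range n, 2 * columnHalf (x + i) ≤
      m * (2 * 2 ^ (q ^ 2)) + 2 * columnHalf x := by
    -- The term `i = 0` is set apart: minimality of `n` says nothing about `x` itself, whose column
    -- is absorbed in `D`.
    rw [hm, Nat.succ_eq_add_one, Finset.sum_range_succ']
    simp only [Nat.cast_zero, add_zero]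
    gcongr
    refine (Finset.sum_le_card_nsmul _ _ (2 * 2 ^ (q ^ 2)) fun i hi => ?_).trans (by simp)
    have := hmin (i + 1) (by omega) (by have := Finset.mem_range.1 hi; omega)
    unfold columnHalf
    gcongr
    · norm_num
  have hh : 2 ^ ((q + 1) ^ 2) ≤ columnHalf (x + n) := by
    unfold columnHalf
    gcongr
    · norm_num
    · omega
  have hDq : D ≤ q := by
    have := Nat.lt_two_pow_self (n := D + 2)
    omega
  have hq3 : 3 ≤ q := by
    have : 2 ^ 2 ≤ 2 ^ (D + 2) := Nat.pow_le_pow_right (by norm_num) (by omega)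
    omega
  -- One share `q + 1` pays for `D`, six for at most `3 (q + 1)` columns of height `2 * 2^(q²)`.
  have hgrow : 7 * (q + 1) ≤ 2 ^ (2 * q + 1) := by
    clear * - hq3
    induction q, hq3 using Nat.le_induction with
    | base => norm_num
    | succ q _ ih =>
      rw [show 2 * (q + 1) + 1 = 2 * q + 1 + 2 by ring, pow_add]
      omega
  have hfin : 7 * (q + 1) * 2 ^ (q ^ 2) ≤ 2 ^ ((q + 1) ^ 2) := by
    rw [show (q + 1) ^ 2 = (2 * q + 1) + q ^ 2 by ring, pow_add]
    gcongr
  have hp : 1 ≤ 2 ^ (q ^ 2) := Nat.one_le_two_pow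
  calc C + ∑ i ∈ Finset.range n, 2 * columnHalf (x + i)
      ≤ D + m * (2 * 2 ^ (q ^ 2)) := by omega
    _ ≤ (q + 1) * 2 ^ (q ^ 2) + 3 * (q + 1) * (2 * 2 ^ (q ^ 2)) := by
        gcongr
        · nlinarith
        · omega
    _ = 7 * (q + 1) * 2 ^ (q ^ 2) := by ring
    _ ≤ _ := hfin.trans hh

variable [MeasurableSpace ℤ_[2]] [BorelSpace ℤ_[2]]

/-- The `2`-adic odometer `x ↦ 1 + x`. -/
noncomputable def odometer : ℤ_[2] ≃ᵐ ℤ_[2] := (Homeomorph.addLeft (1 : ℤ_[2])).toMeasurableEquiv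

theorem odometer_iterate (x : ℤ_[2]) (n : ℕ) : odometer^[n] x = x + n := by
  induction n with
  | zero => simp
  | succ n ih =>
    rw [Function.iterate_succ_apply', ih]
    change 1 + (x + n) = _
    push_cast
    ring

theorem odometer_symm_iterate (x : ℤ_[2]) (n : ℕ) : odometer.symm^[n] x = x - n := by
  induction n with
  | zero => simp
  | succ n ih =>
    rw [Function.iterate_succ_apply', ih]
    change -1 + (x - n) = _
    push_cast
    ring

theorem measurable_invNorm : Measurable invNorm :=
  Nat.measurable_floor.comp measurable_norm.inv

theorem measurable_columnHalf : Measurable columnHalf :=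
  (measurable_from_top (f := fun r : ℕ => 2 ^ (r ^ 2))).comp measurable_invNorm

theorem exists_columnHalf_forward (x : ℤ_[2]) (C : ℕ) :
    ∃ n, C + ∑ i ∈ Finset.range n, 2 * columnHalf (odometer^[i] x) ≤
      columnHalf (odometer^[n] x) := by
  simp_rw [odometer_iterate]
  exact exists_columnHalf_ge x C

theorem exists_columnHalf_backward (x : ℤ_[2]) (C : ℕ) :
    ∃ n, C + ∑ i ∈ Finset.range n, 2 * columnHalf (odometer.symm^[i + 1] x) ≤
      columnHalf (odometer.symm^[n + 1] x) := by
  simp_rw [odometer_symm_iterate]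
  have hneg : ∀ i : ℕ, columnHalf (-x + i) = columnHalf (x - i) := fun i => by
    rw [← columnHalf_neg (x - i)]
    congr 1
    ring
  -- As `columnHalf` is even, the backward orbit of `x` has the heights of the forward orbit of
  -- `-x`. The added `columnHalf x + 1` rules out `n = 0`.
  obtain ⟨n, hn⟩ := exists_columnHalf_ge (-x) (C + columnHalf x + 1)
  simp_rw [hneg] at hn
  cases n with
  | zero =>
    simp at hn
  | succ n =>
    rw [Finset.sum_range_succ'] at hn
    exact ⟨n, by omega⟩

theorem ergodic_odometer : Ergodic (odometer : ℤ_[2] → ℤ_[2]) Measure.addHaar :=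
  ergodic_add_left_of_denseRange_nsmul
    (by simpa using! (PadicInt.denseRange_natCast (p := 2))) _

/-- The tower over the `2`-adic odometer with column heights `2 * columnHalf`. -/
noncomputable def odometerTower : ℤ_[2] × ℕ ≃ᵐ ℤ_[2] × ℕ :=
  skyscraper odometer (fun x => 2 * columnHalf x) (measurable_columnHalf.const_mul 2) columnHalf_pos

/-- The invariant measure on the tower over the `2`-adic odometer. -/
noncomputable def odometerTowerMeasure : Measure (ℤ_[2] × ℕ) :=
  skyscraperMeasure Measure.addHaar fun x => 2 * columnHalf x

/-- The set `B` where `invNorm ≥ Q` has `3 Q` translates covering `ℤ_[2]`, so its measure is at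
least a `1 / (3 Q)` share of the total, while the columns over it exceed `2^(Q²)`. The product is
unbounded in `Q`. -/
theorem odometerTowerMeasure_univ : odometerTowerMeasure Set.univ = ⊤ := by
  set ν : Measure ℤ_[2] := Measure.addHaar
  have hν : ν Set.univ ≠ 0 := (isOpen_univ.measure_pos ν Set.univ_nonempty).ne'
  have key : ∀ N : ℕ, (N : ENNReal) * ν Set.univ ≤ odometerTowerMeasure Set.univ := by
    intro N
    set Q := 2 ^ (N + 1) with hQ
    let B : Set ℤ_[2] := {x | Q ≤ invNorm x}
    have hB : MeasurableSet B := measurableSet_le measurable_const measurable_invNorm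
    have hcover : ν Set.univ ≤ (3 * Q : ℕ) * ν B := by
      calc ν Set.univ ≤ ν (⋃ n ∈ Finset.Icc 1 (3 * Q), odometer^[n] ⁻¹' B) := by
            refine measure_mono fun x _ => ?_
            obtain ⟨n, h1, h2, h3⟩ := exists_le_invNorm_add x (N + 1)
            simp only [Set.mem_iUnion]
            refine ⟨n, Finset.mem_Icc.2 ⟨h1, h2⟩, ?_⟩
            rw [Set.mem_preimage, odometer_iterate]
            exact h3
        _ ≤ ∑ n ∈ Finset.Icc 1 (3 * Q), ν (odometer^[n] ⁻¹' B) := measure_biUnion_finset_le _ _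
        _ = ∑ n ∈ Finset.Icc 1 (3 * Q), ν B := Finset.sum_congr rfl fun n _ =>
            (ergodic_odometer.toMeasurePreserving.iterate n).measure_preimage hB.nullMeasurableSet
        _ = (3 * Q : ℕ) * ν B := by simp
    have hlow : ((2 ^ (Q ^ 2) : ℕ) : ENNReal) * ν B ≤ odometerTowerMeasure Set.univ := by
      rw [odometerTowerMeasure,
        skyscraperMeasure_apply (measurable_columnHalf.const_mul 2) MeasurableSet.univ]
      refine le_trans ?_ (ENNReal.sum_le_tsum (Finset.range (2 ^ (Q ^ 2))))
      have : ((2 ^ (Q ^ 2) : ℕ) : ENNReal) * ν B = ∑ _j ∈ Finset.range (2 ^ (Q ^ 2)), ν B := by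
        rw [Finset.sum_const, Finset.card_range, nsmul_eq_mul]
      rw [this]
      refine Finset.sum_le_sum fun j hj => measure_mono fun x hx => ⟨?_, Set.mem_univ _⟩
      have h1 : 2 ^ (Q ^ 2) ≤ columnHalf x := by
        unfold columnHalf
        exact Nat.pow_le_pow_right (by norm_num) (Nat.pow_le_pow_left hx 2)
      have := Finset.mem_range.1 hj
      omega
    have harith : N * (3 * Q) ≤ 2 ^ (Q ^ 2) := by
      have hNQ : N ≤ Q := by
        have := Nat.lt_two_pow_self (n := N + 1)
        omega
      have hQ2 : 2 ≤ Q := by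
        have : 2 ^ 1 ≤ 2 ^ (N + 1) := Nat.pow_le_pow_right (by norm_num) (by omega)
        omega
      have h4 : ∀ s : ℕ, 4 ≤ s → 3 * s ≤ 2 ^ s := fun s hs => by
        induction s, hs using Nat.le_induction with
        | base => norm_num
        | succ s _ ih => rw [pow_succ]; omega
      calc N * (3 * Q) ≤ Q * (3 * Q) := by gcongr
        _ = 3 * Q ^ 2 := by ring
        _ ≤ _ := h4 _ (by nlinarith)
    calc (N : ENNReal) * ν Set.univ ≤ N * ((3 * Q : ℕ) * ν B) := by gcongr
      _ = ((N * (3 * Q) : ℕ) : ENNReal) * ν B := by push_cast; ring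
      _ ≤ ((2 ^ (Q ^ 2) : ℕ) : ENNReal) * ν B := by gcongr
      _ ≤ _ := hlow
  by_contra htop
  obtain ⟨N, hN⟩ := ENNReal.exists_nat_mul_gt hν htop
  exact absurd (key N) (not_le.2 hN)

theorem isInfiniteErgodicSystem_odometerTower :
    IsInfiniteErgodicSystem odometerTowerMeasure odometerTower where
  sigmaFinite := inferInstanceAs (SigmaFinite (skyscraperMeasure _ _))
  infinite := odometerTowerMeasure_univ
  ergodic := ergodic_skyscraper ergodic_odometer
  conservative := conservative_skyscraper ergodic_odometer.toMeasurePreserving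

end Odometer

/-! ### Existence of the exponents by ergodicity. -/

section Existence

variable {Ω : Type*} [MeasurableSpace Ω]

theorem measurable_transferProduct {Z : ℕ → Ω → ℂ} (hZ : ∀ k, Measurable (Z k)) (n : ℕ)
    (i j : Fin 2) : Measurable fun ω => transferProduct (fun k => Z k ω) n i j := by
  induction n generalizing i with
  | zero => exact measurable_const
  | succ n ih =>
    rcases (by omega : i = 0 ∨ i = 1) with rfl | rfl
    · simp_rw [transferProduct_succ_zero]
      exact ((hZ n).mul (ih 0)).sub (ih 1)
    · simp_rw [transferProduct_succ_one]
      exact ih 0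

theorem measurable_productRate {Z : ℕ → Ω → ℂ} (hZ : ∀ k, Measurable (Z k)) (n : ℕ) :
    Measurable fun ω => productRate (fun k => Z k ω) n := by
  have hcont : Continuous fun A : Fin 2 → Fin 2 → ℂ => ‖Matrix.of A‖ :=
    continuous_norm.comp (continuous_id : Continuous fun A : Matrix (Fin 2) (Fin 2) ℂ => A)
  have hnorm : Measurable fun A : Fin 2 → Fin 2 → ℂ => ‖Matrix.of A‖ := hcont.measurable
  have h : Measurable fun ω => ‖transferProduct (fun k => Z k ω) n‖ :=
    hnorm.comp (measurable_pi_lambda _ fun i => measurable_pi_lambda _ fun j =>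
      measurable_transferProduct hZ n i j)
  exact (Real.measurable_log.comp h).const_mul _

variable {μ : Measure Ω} {T : Ω ≃ᵐ Ω} {f : Ω → ℝ}

theorem IsSamplingFunction.exists_norm_sub_le (hf : IsSamplingFunction f) (E : ℂ) :
    ∃ C : ℝ, ∀ ω, ‖E - (f ω : ℂ)‖ ≤ C := by
  obtain ⟨C, hC⟩ := hf.bounded
  refine ⟨‖E‖ + C, fun ω => (norm_sub_le _ _).trans ?_⟩
  rw [Complex.norm_real]
  gcongr
  exact hC ω

theorem measurable_forward (hf : IsSamplingFunction f) (E : ℂ) (k : ℕ) :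
    Measurable fun ω => E - (f (T^[k] ω) : ℂ) :=
  (Complex.measurable_ofReal.comp (hf.measurable.comp (T.measurable.iterate k))).const_sub E

theorem measurable_backward (hf : IsSamplingFunction f) (E : ℂ) (k : ℕ) :
    Measurable fun ω => E - (f (T.symm^[k + 1] ω) : ℂ) :=
  (Complex.measurable_ofReal.comp
    (hf.measurable.comp (T.symm.measurable.iterate (k + 1)))).const_sub E

theorem symm_iterate_succ_apply (T : Ω ≃ᵐ Ω) (k : ℕ) (ω : Ω) :
    T.symm^[k + 1] (T ω) = T.symm^[k] ω := by
  rw [Function.iterate_succ_apply, MeasurableEquiv.symm_apply_apply]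

theorem exists_isUpperLyapunov_atTop (hT : Ergodic T μ) (hf : IsSamplingFunction f) (E : ℂ) :
    ∃ L, IsUpperLyapunov μ T f atTop E L := by
  obtain ⟨C, hC⟩ := hf.exists_norm_sub_le E
  obtain ⟨L, hL⟩ := hT.toPreErgodic.ae_eq_const_of_ae_eq_comp
    (Measurable.limsup (measurable_productRate (measurable_forward (T := T) hf E)))
    (funext fun ω => limsup_productRate_shift
      (z := fun k => E - (f (T^[k] ω) : ℂ)) fun k => hC _)
  exact ⟨L, hL.mono fun ω h => (limsup_growthRate_atTop T f E ω).trans h⟩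

theorem exists_isLowerLyapunov_atTop (hT : Ergodic T μ) (hf : IsSamplingFunction f) (E : ℂ) :
    ∃ L, IsLowerLyapunov μ T f atTop E L := by
  obtain ⟨C, hC⟩ := hf.exists_norm_sub_le E
  obtain ⟨L, hL⟩ := hT.toPreErgodic.ae_eq_const_of_ae_eq_comp
    (Measurable.liminf (measurable_productRate (measurable_forward (T := T) hf E)))
    (funext fun ω => liminf_productRate_shift
      (z := fun k => E - (f (T^[k] ω) : ℂ)) fun k => hC _)
  exact ⟨L, hL.mono fun ω h => (liminf_growthRate_atTop T f E ω).trans h⟩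

theorem exists_isUpperLyapunov_atBot (hT : Ergodic T μ) (hf : IsSamplingFunction f) (E : ℂ) :
    ∃ L, IsUpperLyapunov μ T f atBot E L := by
  obtain ⟨C, hC⟩ := hf.exists_norm_sub_le E
  obtain ⟨L, hL⟩ := hT.toPreErgodic.ae_eq_const_of_ae_eq_comp
    (Measurable.limsup (measurable_productRate (measurable_backward (T := T) hf E)))
    (funext fun ω => by
      -- The backward sequence of `T ω` starts at `f ω`; dropping that term leaves the backward
      -- sequence of `ω`.
      have h := limsup_productRate_shift
        (z := fun k => E - (f (T.symm^[k + 1] (T ω)) : ℂ)) fun k => hC _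
      simp_rw [symm_iterate_succ_apply T (_ + 1)] at h
      exact h.symm)
  exact ⟨L, hL.mono fun ω h => (limsup_growthRate_atBot T f E ω).trans h⟩

theorem exists_isLowerLyapunov_atBot (hT : Ergodic T μ) (hf : IsSamplingFunction f) (E : ℂ) :
    ∃ L, IsLowerLyapunov μ T f atBot E L := by
  obtain ⟨C, hC⟩ := hf.exists_norm_sub_le E
  obtain ⟨L, hL⟩ := hT.toPreErgodic.ae_eq_const_of_ae_eq_comp
    (Measurable.liminf (measurable_productRate (measurable_backward (T := T) hf E)))
    (funext fun ω => by
      have h := liminf_productRate_shift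
        (z := fun k => E - (f (T.symm^[k + 1] (T ω)) : ℂ)) fun k => hC _
      simp_rw [symm_iterate_succ_apply T (_ + 1)] at h
      exact h.symm)
  exact ⟨L, hL.mono fun ω h => (liminf_growthRate_atBot T f E ω).trans h⟩

end Existence

/-! ### Comparison of the two directions at large energies. -/

section Comparison

variable [MeasurableSpace ℤ_[2]] [BorelSpace ℤ_[2]]

theorem growthRate_lt_of_large {ω : ℤ_[2] × ℕ} (hω : ω.2 < 2 * columnHalf ω.1) {E : ℝ}
    (hE : 18 < E) :
    limsup (fun n => growthRate odometerTower (halfSign columnHalf) E n ω) atBot <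
        limsup (fun n => growthRate odometerTower (halfSign columnHalf) E n ω) atTop ∧
      liminf (fun n => growthRate odometerTower (halfSign columnHalf) E n ω) atBot <
        liminf (fun n => growthRate odometerTower (halfSign columnHalf) E n ω) atTop := by
  have hnorm : ∀ ω, ‖(E : ℂ) - (halfSign columnHalf ω : ℂ)‖ = E - halfSign columnHalf ω := by
    intro ω
    rw [← Complex.ofReal_sub, Complex.norm_real, Real.norm_of_nonneg]
    rcases halfSign_eq columnHalf ω with h | h <;> rw [h] <;> linarith
  rw [limsup_growthRate_atTop, limsup_growthRate_atBot, liminf_growthRate_atTop,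
    liminf_growthRate_atBot]
  refine productRate_lt hE (fun k => halfSign_eq columnHalf (odometerTower^[k] ω))
    (fun k => hnorm _) (fun k => halfSign_eq columnHalf (odometerTower.symm^[k + 1] ω))
    (fun k => hnorm _) (C := tent columnHalf ω) (fun n => ?_)
    (frequently_sum_halfSign_forward exists_columnHalf_forward hω) (fun n => ?_)
    (frequently_sum_halfSign_backward exists_columnHalf_backward hω)
  · rw [odometerTower, sum_halfSign_forward hω]
    linarith [tent_nonneg (skyscraper_iterate_mem (S := odometer)
      (hφ := measurable_columnHalf.const_mul 2) (hpos := columnHalf_pos) hω n)]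
  · rw [odometerTower, sum_halfSign_backward hω]
    linarith [tent_nonneg (skyscraper_symm_iterate_mem (S := odometer)
      (hφ := measurable_columnHalf.const_mul 2) (hpos := columnHalf_pos) hω n)]

/-- For negative energy `|E - f| = |E| - (-f)`: the signs are reversed, so the backward sequence now
has sums bounded above and frequently very negative. -/
theorem growthRate_lt_of_small {ω : ℤ_[2] × ℕ} (hω : ω.2 < 2 * columnHalf ω.1) {E : ℝ}
    (hE : E < -18) :
    limsup (fun n => growthRate odometerTower (halfSign columnHalf) E n ω) atTop <
        limsup (fun n => growthRate odometerTower (halfSign columnHalf) E n ω) atBot ∧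
      liminf (fun n => growthRate odometerTower (halfSign columnHalf) E n ω) atTop <
        liminf (fun n => growthRate odometerTower (halfSign columnHalf) E n ω) atBot := by
  have hnorm : ∀ ω, ‖(E : ℂ) - (halfSign columnHalf ω : ℂ)‖ = -E - -halfSign columnHalf ω := by
    intro ω
    rw [← Complex.ofReal_sub, Complex.norm_real, Real.norm_of_nonpos]
    · ring
    · rcases halfSign_eq columnHalf ω with h | h <;> rw [h] <;> linarith
  have hsign : ∀ ω, -halfSign columnHalf ω = 1 ∨ -halfSign columnHalf ω = -1 := fun ω => by
    rcases halfSign_eq columnHalf ω with h | h <;> rw [h] <;> simp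
  rw [limsup_growthRate_atTop, limsup_growthRate_atBot, liminf_growthRate_atTop,
    liminf_growthRate_atBot]
  refine productRate_lt (by linarith) (fun k => hsign (odometerTower.symm^[k + 1] ω))
    (fun k => hnorm _) (fun k => hsign (odometerTower^[k] ω))
    (fun k => hnorm _) (C := tent columnHalf ω) (fun n => ?_) ?_ (fun n => ?_) ?_
  · rw [Finset.sum_neg_distrib, odometerTower, sum_halfSign_backward hω]
    linarith [tent_nonneg (skyscraper_symm_iterate_mem (S := odometer)
      (hφ := measurable_columnHalf.const_mul 2) (hpos := columnHalf_pos) hω n)]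
  · refine (frequently_sum_halfSign_backward (hφ := measurable_columnHalf.const_mul 2)
      (hpos := columnHalf_pos) exists_columnHalf_backward hω).mono fun n hn => ?_
    rw [Finset.sum_neg_distrib]
    exact neg_le_neg hn
  · rw [Finset.sum_neg_distrib, odometerTower, sum_halfSign_forward hω]
    linarith [tent_nonneg (skyscraper_iterate_mem (S := odometer)
      (hφ := measurable_columnHalf.const_mul 2) (hpos := columnHalf_pos) hω n)]
  · refine (frequently_sum_halfSign_forward (hφ := measurable_columnHalf.const_mul 2)
      (hpos := columnHalf_pos) exists_columnHalf_forward hω).mono fun n hn => ?_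
    rw [Finset.sum_neg_distrib]
    exact le_neg_of_le_neg hn

theorem exists_odometerTower_mem_of_ae {p : ℤ_[2] × ℕ → Prop}
    (h : ∀ᵐ ω ∂odometerTowerMeasure, p ω) : ∃ ω, ω.2 < 2 * columnHalf ω.1 ∧ p ω := by
  have : NeBot (ae odometerTowerMeasure) := by
    rw [ae_neBot]
    intro h0
    have := odometerTowerMeasure_univ
    simp [h0] at this
  have hD : ∀ᵐ ω ∂odometerTowerMeasure, ω.2 < 2 * columnHalf ω.1 :=
    ae_restrict_mem (measurableSet_below (measurable_columnHalf.const_mul 2))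
  exact (hD.and h).exists

end Comparison

theorem mainTheorem12 :
    (∃ (Ω : Type) (_ : MeasurableSpace Ω) (μ : Measure Ω) (T : Ω ≃ᵐ Ω) (f : Ω → ℝ)
        (Lplus Lminus : ℂ → ℝ) (M : ℝ),
      IsInfiniteErgodicSystem μ T ∧ IsSamplingFunction f ∧ 0 < M ∧
      (∀ E : ℂ, IsUpperLyapunov μ T f atTop E (Lplus E)) ∧
      (∀ E : ℂ, IsUpperLyapunov μ T f atBot E (Lminus E)) ∧
      (∀ E : ℝ, M < E → Lplus (E : ℂ) > Lminus (E : ℂ)) ∧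
      (∀ E : ℝ, E < -M → Lplus (E : ℂ) < Lminus (E : ℂ))) ∧
    (∃ (Ω : Type) (_ : MeasurableSpace Ω) (μ : Measure Ω) (T : Ω ≃ᵐ Ω) (f : Ω → ℝ)
        (Lplus Lminus : ℂ → ℝ) (M : ℝ),
      IsInfiniteErgodicSystem μ T ∧ IsSamplingFunction f ∧ 0 < M ∧
      (∀ E : ℂ, IsLowerLyapunov μ T f atTop E (Lplus E)) ∧
      (∀ E : ℂ, IsLowerLyapunov μ T f atBot E (Lminus E)) ∧
      (∀ E : ℝ, M < E → Lplus (E : ℂ) > Lminus (E : ℂ)) ∧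
      (∀ E : ℝ, E < -M → Lplus (E : ℂ) < Lminus (E : ℂ))) := by
  borelize ℤ_[2]
  have hsys := isInfiniteErgodicSystem_odometerTower
  have hf := isSamplingFunction_halfSign measurable_columnHalf
  constructor
  · choose Lp hLp using exists_isUpperLyapunov_atTop hsys.ergodic hf
    choose Lm hLm using exists_isUpperLyapunov_atBot hsys.ergodic hf
    -- The comparison holds at every point of the tower, so one point at which both exponents are
    -- attained suffices for each `E`.
    refine ⟨_, _, _, _, _, Lp, Lm, 18, hsys, hf, by norm_num, hLp, hLm, fun E hE => ?_,
      fun E hE => ?_⟩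
    · obtain ⟨ω, hω, h1, h2⟩ := exists_odometerTower_mem_of_ae ((hLp E).and (hLm E))
      rw [← h1, ← h2]
      exact (growthRate_lt_of_large hω hE).1
    · obtain ⟨ω, hω, h1, h2⟩ := exists_odometerTower_mem_of_ae ((hLp E).and (hLm E))
      rw [← h1, ← h2]
      exact (growthRate_lt_of_small hω hE).1
  · choose Lp hLp using exists_isLowerLyapunov_atTop hsys.ergodic hf
    choose Lm hLm using exists_isLowerLyapunov_atBot hsys.ergodic hf
    refine ⟨_, _, _, _, _, Lp, Lm, 18, hsys, hf, by norm_num, hLp, hLm, fun E hE => ?_,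
      fun E hE => ?_⟩
    · obtain ⟨ω, hω, h1, h2⟩ := exists_odometerTower_mem_of_ae ((hLp E).and (hLm E))
      rw [← h1, ← h2]
      exact (growthRate_lt_of_large hω hE).2
    · obtain ⟨ω, hω, h1, h2⟩ := exists_odometerTower_mem_of_ae ((hLp E).and (hLm E))
      rw [← h1, ← h2]
      exact (growthRate_lt_of_small hω hE).2
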